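/- Let $p$ be a prime number and let $(A,\mathfrak m_0,k)\to(R,\mathfrak m,K)$ be a finite (injective) extension of $F$-finite Noetherian local rings of characteristic $p$, where $R$ is a complete domain. Let $E_A(k)$ and $E_R(K)$ be injective hulls of the residue fields, let $M=E_A(k)\otimes_A R$, and let $M^\vee=\mathrm{Hom}_R(M,E_R(K))$. For a submodule $N$ of an $R$-module $L$, let $N^*_L$ be its tight closure: $x\in N^*_L$ if there is an element $c$ of $R$ outside all minimal primes with $c\otimes x\in\mathrm{Im}(F^e(N)\to F^e(L))$ for all $e\gg 0$, where $F^e(L)=R^e\otimes_R L$ is the base change of $L$ along the $e$-th iterate of Frobenius. For an ideal $I$ of $R$ put $I^*=I^*_R$. Let $0^{*fg}_M=\bigcup_{M'}0^*_{M'}$, the union being over all finitely generated submodules $M'\subset M$. The module of relative test elements is $$T(R,A)=\{f\in M^\vee : f(x)=0 \text{ for all } x\in 0^{*fg}_M\}.$$ Then $T(R,A)$ is a strong test module for $R$; that is, it is a faithful $R$-module and $I\,T(R,A)=I^*\,T(R,A)$ for every ideal $I$ of $R$. Moreover, there is an isomorphism of $R$-modules $M^\vee\cong\mathrm{Hom}_A(R,A)$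 which identifies $T(R,A)$ with the submodule of all $\varphi\in\mathrm{Hom}_A(R,A)$ such that $\mathrm{id}_{E_A(k)}\otimes\varphi: E_A(k)\otimes_A R\to E_A(k)$ vanishes on $0^{*fg}_M$; in this sense $T(R,A)\subset\mathrm{Hom}_A(R,A)$. -/

import Mathlib

open scoped TensorProduct

universe u v w

namespace TightClosure

section InjectiveHull

/-- `E`, with the embedding `i : M → E`, is an injective hull of the `R`-module `M`: the module `E`
is injective and is an essential extension of `M`. -/
structure IsInjectiveHull (R : Type u) [CommRing R] {M E : Type u} [AddCommGroup M] [Module R M]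
    [AddCommGroup E] [Module R E] (i : M →ₗ[R] E) : Prop where
  injective_module : Module.Injective R E
  injective : Function.Injective i
  essential : ∀ N : Submodule R E, N ⊓ LinearMap.range i = ⊥ → N = ⊥

/-- Every module has an injective hull. -/
theorem exists_isInjectiveHull (R : Type u) [CommRing R] (M : Type u) [AddCommGroup M]
    [Module R M] :
    ∃ (E : ModuleCat.{u} R) (i : M →ₗ[R] E), IsInjectiveHull R i := by
  obtain ⟨⟨J', hJ', f, hf⟩⟩ :=
    CategoryTheory.EnoughInjectives.presentation (ModuleCat.of R M)
  obtain ⟨J, i, hi, hJ⟩ : ∃ (J : ModuleCat.{u} R) (i : M →ₗ[R] J), Function.Injective i ∧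
      Module.Injective R J :=
    ⟨J', f.hom, (ModuleCat.mono_iff_injective f).1 hf,
      Module.injective_module_of_injective_object R J'⟩
  clear hf f hJ' J'
  -- a maximal essential extension `E` of `M` inside `J`
  obtain ⟨E, hE⟩ : ∃ E, Maximal (fun E : Submodule R J => LinearMap.range i ≤ E ∧
      ∀ N ≤ E, N ⊓ LinearMap.range i = ⊥ → N = ⊥) E := by
    obtain ⟨E, -, hE⟩ := zorn_le_nonempty₀ {E : Submodule R J | LinearMap.range i ≤ E ∧
      ∀ N ≤ E, N ⊓ LinearMap.range i = ⊥ → N = ⊥} (fun c hc hcc y hy => by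
        refine ⟨sSup c, ⟨(hc hy).1.trans (le_sSup hy), fun N hN hNi => ?_⟩,
          fun z hz => le_sSup hz⟩
        rw [eq_bot_iff]
        intro x hx
        obtain ⟨E, hEc, hxE⟩ := (Submodule.mem_sSup_of_directed ⟨y, hy⟩ hcc.directedOn).1 (hN hx)
        have hs : Submodule.span R {x} = ⊥ := by
          refine (hc hEc).2 _ (by simpa using hxE) ?_
          rw [eq_bot_iff, ← hNi]
          exact inf_le_inf_right _ (by simpa using hx)
        simpa using hs) (LinearMap.range i) ⟨le_rfl, fun N hN h => by
          rwa [inf_eq_left.2 hN] at h⟩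
    exact ⟨E, hE⟩
  -- a maximal submodule `C` of `J` that meets `E` trivially
  obtain ⟨C, hC⟩ : ∃ C, Maximal (fun C : Submodule R J => C ⊓ E = ⊥) C := by
    obtain ⟨C, -, hC⟩ := zorn_le_nonempty₀ {C : Submodule R J | C ⊓ E = ⊥}
      (fun c hc hcc y hy => by
        refine ⟨sSup c, ?_, fun z hz => le_sSup hz⟩
        rw [Set.mem_ofPred_eq, eq_bot_iff]
        rintro x ⟨hx, hxE⟩
        obtain ⟨D, hD, hxD⟩ := (Submodule.mem_sSup_of_directed ⟨y, hy⟩ hcc.directedOn).1 hx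
        have := hc hD
        rw [Set.mem_ofPred_eq] at this
        rw [← this]
        exact ⟨hxD, hxE⟩) ⊥ (by simp)
    exact ⟨C, hC⟩
  have hCE : ∀ x ∈ E, x ∈ C → x = 0 := fun x hx hxC => by
    have : x ∈ C ⊓ E := ⟨hxC, hx⟩
    rw [hC.prop] at this
    simpa using this
  obtain ⟨h, hh⟩ := hJ.out (C.mkQ ∘ₗ E.subtype) (by
    rw [← LinearMap.ker_eq_bot, eq_bot_iff]
    intro x hx
    have : (x : J) ∈ C := by simpa using hx
    simpa using hCE x x.2 this) E.subtype
  have hh' : ∀ x ∈ E, h (C.mkQ x) = x := fun x hx => hh ⟨x, hx⟩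
  have hle : E ≤ LinearMap.range h := fun x hx => ⟨C.mkQ x, hh' x hx⟩
  have hrange : LinearMap.range h ≤ E := by
    refine hE.le_of_ge ⟨hE.prop.1.trans hle, fun L hL hLi => ?_⟩ hle
    have hLE : L ⊓ E = ⊥ := by
      refine hE.prop.2 _ inf_le_right ?_
      rw [eq_bot_iff, ← hLi]
      exact inf_le_inf_right _ inf_le_left
    have hK : L.comap (h ∘ₗ C.mkQ) ≤ C := by
      refine hC.le_of_ge ?_ ?_
      · rw [eq_bot_iff, ← hLE]
        rintro x ⟨hx, hxE⟩
        have : h (C.mkQ x) ∈ L := hx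
        rw [hh' x hxE] at this
        exact ⟨this, hxE⟩
      · intro x hx
        have : C.mkQ x = 0 := by simpa using hx
        simp only [Submodule.mem_comap, LinearMap.comp_apply, this, map_zero, L.zero_mem]
    rw [eq_bot_iff]
    intro x hx
    obtain ⟨y, rfl⟩ := hL hx
    obtain ⟨y, rfl⟩ := C.mkQ_surjective y
    have : C.mkQ y = 0 := by simpa using hK hx
    simp [this]
  let π : J →ₗ[R] E := (h ∘ₗ C.mkQ).codRestrict E fun x => hrange ⟨_, rfl⟩
  have hπ : ∀ x : E, π x = x := fun x => Subtype.ext (hh' x x.2)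
  refine ⟨ModuleCat.of R E, i.codRestrict E fun x => hE.prop.1 ⟨x, rfl⟩, ⟨⟨?_⟩, ?_, ?_⟩⟩
  · intro X Y _ _ _ _ f hf g
    obtain ⟨k, hk⟩ := hJ.out f hf (E.subtype ∘ₗ g)
    refine ⟨π ∘ₗ k, fun x => ?_⟩
    rw [LinearMap.comp_apply, hk]
    exact hπ (g x)
  · intro x y hxy
    exact hi (congrArg Subtype.val hxy)
  · intro N hN
    have h0 : N.map E.subtype = ⊥ := by
      refine hE.prop.2 _ (by rintro _ ⟨x, -, rfl⟩; exact x.2) ?_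
      rw [eq_bot_iff]
      rintro _ ⟨⟨x, hx, rfl⟩, y, hy⟩
      have hx' : x ∈ N ⊓ LinearMap.range (i.codRestrict E fun x => hE.prop.1 ⟨x, rfl⟩) :=
        ⟨hx, y, Subtype.ext hy⟩
      rw [hN] at hx'
      have : x = 0 := by simpa using hx'
      simp [this]
    exact Submodule.map_injective_of_injective E.injective_subtype (by rw [h0, Submodule.map_bot])

/-- The injective hull `E_R(K)` of the residue field `K` of a local ring `R` (well defined up to
isomorphism; one such hull is chosen). -/
noncomputable def ResidueHull (R : Type u) [CommRing R] [IsLocalRing R] : Type u :=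
  (exists_isInjectiveHull R (IsLocalRing.ResidueField R)).choose

noncomputable instance (R : Type u) [CommRing R] [IsLocalRing R] :
    AddCommGroup (ResidueHull R) :=
  inferInstanceAs
    (AddCommGroup (exists_isInjectiveHull R (IsLocalRing.ResidueField R)).choose)

noncomputable instance (R : Type u) [CommRing R] [IsLocalRing R] :
    Module R (ResidueHull R) :=
  inferInstanceAs
    (Module R (exists_isInjectiveHull R (IsLocalRing.ResidueField R)).choose)

/-- `ResidueHull R` is an injective hull of the residue field. -/
theorem residueHull_spec (R : Type u) [CommRing R] [IsLocalRing R] :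
    ∃ i : IsLocalRing.ResidueField R →ₗ[R] ResidueHull R, IsInjectiveHull R i :=
  (exists_isInjectiveHull R (IsLocalRing.ResidueField R)).choose_spec

/-- The Matlis dual `Hom_R(M, E_R(K))` of a module over a local ring. -/
abbrev MatlisDual (R : Type u) [CommRing R] [IsLocalRing R] (M : Type v) [AddCommGroup M]
    [Module R M] : Type (max u v) :=
  M →ₗ[R] ResidueHull R

end InjectiveHull

section TightClosure

/-- `R` is `F`-finite: it is a finite module over itself through the Frobenius endomorphism. -/
def IsFFinite (p : ℕ) (R : Type u) [CommRing R] [ExpChar R p] : Prop :=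
  (frobenius R p).Finite

/-- `R^e`: the ring `R` seen as an `R`-algebra through the `e`-th iterate of Frobenius. -/
@[nolint unusedArguments]
def FrobeniusPower (_p _e : ℕ) (R : Type u) : Type u := R

instance (p e : ℕ) (R : Type u) [CommRing R] : CommRing (FrobeniusPower p e R) :=
  inferInstanceAs (CommRing R)

instance (p e : ℕ) (R : Type u) [CommRing R] [ExpChar R p] :
    Algebra R (FrobeniusPower p e R) :=
  RingHom.toAlgebra (S := FrobeniusPower p e R) (iterateFrobenius R p e)

/-- The identity map `R → R^e` (an isomorphism of rings, not of `R`-algebras). -/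
def FrobeniusPower.of (p e : ℕ) (R : Type u) [CommRing R] : R ≃+* FrobeniusPower p e R :=
  RingEquiv.refl R

theorem FrobeniusPower.algebraMap_eq (p e : ℕ) (R : Type u) [CommRing R] [ExpChar R p] (r : R) :
    algebraMap R (FrobeniusPower p e R) r = FrobeniusPower.of p e R (r ^ p ^ e) :=
  rfl

/-- The submodule `N^{[q]}_M`, `q = p ^ e`, of `F^e(M) = R^e ⊗ M`: the image of `F^e(N)`. -/
noncomputable def frobeniusImage (p e : ℕ) {R : Type u} [CommRing R] [ExpChar R p] {M : Type v}
    [AddCommGroup M] [Module R M] (N : Submodule R M) :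
    Submodule (FrobeniusPower p e R) (FrobeniusPower p e R ⊗[R] M) :=
  LinearMap.range (N.subtype.baseChange (FrobeniusPower p e R))

/-- `R°`: the complement of the union of the minimal primes of `R`. -/
def minimalPrimesCompl (R : Type u) [CommRing R] : Submonoid R where
  carrier := {c | ∀ P ∈ minimalPrimes R, c ∉ P}
  one_mem' P hP h := hP.1.1.ne_top ((Ideal.eq_top_iff_one P).2 h)
  mul_mem' {_ _} ha hb P hP h := (hP.1.1.mem_or_mem h).elim (ha P hP) (hb P hP)

/-- The tight closure `N^*_M` of a submodule `N` of `M`: those `m` for which there is `c ∈ R°` with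
`c ⊗ m ∈ N^{[q]}_M` for all large `q = p ^ e`. For `M = R` this is the tight closure of an ideal. -/
def tightClosure (p : ℕ) {R : Type u} [CommRing R] [ExpChar R p] {M : Type v} [AddCommGroup M]
    [Module R M] (N : Submodule R M) : Submodule R M where
  carrier := {m | ∃ c ∈ minimalPrimesCompl R, ∃ e₀ : ℕ, ∀ e ≥ e₀,
    FrobeniusPower.of p e R c ⊗ₜ[R] m ∈ frobeniusImage p e N}
  zero_mem' := ⟨1, one_mem _, 0, fun e _ => by
    rw [TensorProduct.tmul_zero]; exact zero_mem _⟩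
  add_mem' := by
    rintro a b ⟨c, hc, e₀, h⟩ ⟨d, hd, e₁, h'⟩
    refine ⟨c * d, mul_mem hc hd, max e₀ e₁, fun e he => ?_⟩
    have h1 := (frobeniusImage p e N).smul_mem (FrobeniusPower.of p e R d)
      (h e (le_of_max_le_left he))
    have h2 := (frobeniusImage p e N).smul_mem (FrobeniusPower.of p e R c)
      (h' e (le_of_max_le_right he))
    rw [TensorProduct.smul_tmul', smul_eq_mul] at h1 h2
    rw [TensorProduct.tmul_add, map_mul]
    refine add_mem ?_ h2
    rwa [mul_comm]
  smul_mem' := by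
    rintro r a ⟨c, hc, e₀, h⟩
    refine ⟨c, hc, e₀, fun e he => ?_⟩
    have h1 := (frobeniusImage p e N).smul_mem (algebraMap R (FrobeniusPower p e R) r) (h e he)
    rwa [algebraMap_smul, ← TensorProduct.tmul_smul] at h1

/-- Tight closure is compatible with linear maps. -/
theorem tightClosure_map (p : ℕ) {R : Type u} [CommRing R] [ExpChar R p] {M : Type v}
    [AddCommGroup M] [Module R M] {M' : Type w} [AddCommGroup M'] [Module R M'] (f : M →ₗ[R] M')
    {N : Submodule R M} {N' : Submodule R M'} (hf : N ≤ N'.comap f) {m : M}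
    (hm : m ∈ tightClosure p N) : f m ∈ tightClosure p N' := by
  obtain ⟨c, hc, e₀, h⟩ := hm
  refine ⟨c, hc, e₀, fun e he => ?_⟩
  obtain ⟨y, hy⟩ := h e he
  refine ⟨(f.restrict hf).baseChange (FrobeniusPower p e R) y, ?_⟩
  have := congrArg (f.baseChange (FrobeniusPower p e R)) hy
  rw [LinearMap.baseChange_tmul] at this
  rw [← this, ← LinearMap.comp_apply, ← LinearMap.comp_apply, ← LinearMap.baseChange_comp,
    ← LinearMap.baseChange_comp]
  rfl

/-- The finitistic tight closure `N^{*fg}_M`: the union of the tight closures `(N ∩ M')^*_{M'}` over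
the finitely generated submodules `M'` of `M`. -/
def finitisticTightClosure (p : ℕ) {R : Type u} [CommRing R] [ExpChar R p] {M : Type v}
    [AddCommGroup M] [Module R M] (N : Submodule R M) : Submodule R M where
  carrier := {m | ∃ M' : Submodule R M, M'.FG ∧
    ∃ hm : m ∈ M', (⟨m, hm⟩ : M') ∈ tightClosure p (N.comap M'.subtype)}
  zero_mem' := ⟨⊥, Submodule.fg_bot, zero_mem _, zero_mem _⟩
  add_mem' := by
    rintro a b ⟨M₁, hM₁, ha, h⟩ ⟨M₂, hM₂, hb, h'⟩
    refine ⟨M₁ ⊔ M₂, hM₁.sup hM₂,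
      add_mem (Submodule.mem_sup_left ha) (Submodule.mem_sup_right hb), ?_⟩
    exact add_mem
      (tightClosure_map p (Submodule.inclusion (le_sup_left : M₁ ≤ M₁ ⊔ M₂))
        (N' := N.comap (M₁ ⊔ M₂).subtype) (fun x hx => hx) h)
      (tightClosure_map p (Submodule.inclusion (le_sup_right : M₂ ≤ M₁ ⊔ M₂))
        (N' := N.comap (M₁ ⊔ M₂).subtype) (fun x hx => hx) h')
  smul_mem' := by
    rintro r a ⟨M', hM', ha, h⟩
    exact ⟨M', hM', M'.smul_mem r ha, Submodule.smul_mem _ r h⟩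

end TightClosure

section TestModules

/-- The test module `τ^{fg}_M`: the annihilator of `0^{*fg}_M` in the Matlis dual of `M`, under the
evaluation pairing. -/
def finitisticTestModule (p : ℕ) (R : Type u) [CommRing R] [IsLocalRing R] [ExpChar R p]
    (M : Type v) [AddCommGroup M] [Module R M] : Submodule R (MatlisDual R M) where
  carrier := {n | ∀ x ∈ finitisticTightClosure p (⊥ : Submodule R M), n x = 0}
  zero_mem' _ _ := rfl
  add_mem' ha hb x hx := by rw [LinearMap.add_apply, ha x hx, hb x hx, add_zero]
  smul_mem' r n hn x hx := by rw [LinearMap.smul_apply, hn x hx, smul_zero]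

/-- The module of relative test elements `T(R, A)`: the test module `τ^{fg}_M` of the `R`-module
`M = R ⊗_A E_A(k)`, where `k` is the residue field of `A`. -/
noncomputable def relativeTestModule (p : ℕ) (A : Type u) (R : Type v) [CommRing A] [IsLocalRing A]
    [CommRing R] [IsLocalRing R] [ExpChar R p] [Algebra A R] :
    Submodule R (MatlisDual R (R ⊗[A] ResidueHull A)) :=
  finitisticTestModule p R (R ⊗[A] ResidueHull A)

/-- `T` has the strong test module property: `I T = I^* T` for every ideal `I` of `R`. -/
def HasStrongTestModuleProperty (p : ℕ) (R : Type u) [CommRing R] [ExpChar R p] (T : Type v)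
    [AddCommGroup T] [Module R T] : Prop :=
  ∀ I : Ideal R, I • (⊤ : Submodule R T) = (tightClosure p I : Ideal R) • (⊤ : Submodule R T)

/-- A strong test module: a faithful module with the strong test module property. -/
structure IsStrongTestModule (p : ℕ) (R : Type u) [CommRing R] [ExpChar R p] (T : Type v)
    [AddCommGroup T] [Module R T] : Prop where
  faithful : Module.annihilator R T = ⊥
  strong : HasStrongTestModuleProperty p R T

end TestModules

end TightClosure

/-! Write `M = R ⊗ E_A(k)`, `E = E_R(K)` and `Z = 0^{*fg}_M`, so that `T(R, A) = Hom_R(M/Z, E)`.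

Strong property: let `f ∈ T` and `x ∈ I^*`. If `I z ⊆ Z`, then `I^* z ⊆ Z`, because multipliers for
`c a^q ⊗ z = 0` and for `d x^q ∈ I^{[q]}` combine to `c d x^q ⊗ z = 0`
(`finitisticTightClosure_smul_mem`). Hence `x f` kills `(Z : I)`, the kernel of `M → (M/Z)^n`, `z ↦
(a_i z)`, where the `a_i` generate `I`. Injectivity of `E` extends `x f` over this map, and the
components of the extension write `x f` as `∑ a_i g_i` with `g_i ∈ T`
(`exists_sum_smul_of_colon_le`).

Identification: `E ≅ Hom_A(R, E_A(k))` through a trace `t : E → E_A(k)` (`exists_residue_trace`).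
Since `R` is complete and finite over `A`, the ring `A` is complete, so `End_A(E_A(k)) = A`.
Adjunction gives `M^∨ ≅ Hom_A(M, E_A(k)) ≅ Hom_A(R, A)`, under which `id ⊗ φ` is `t ∘ f`
(`exists_dual_equiv`).

Faithfulness: some `C ≠ 0` kills `Z`, so `C M^∨ ⊆ T`, and `M^∨ ≅ Hom_A(R, A)` is nonzero and
torsion-free over the domain `R`. The element `C` comes from `exists_cartier_test_element`: a single
`C ≠ 0` is a value `φ(d)` of `p⁻ᵉ`-linear maps for every `d ≠ 0` and arbitrarily large `e`. -/

namespace TightClosure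

/-! ### `p⁻ᵉ`-linear maps and a uniform test element. -/

section Cartier

/-- A finitely generated module over a domain is free up to multiplication by a nonzero scalar:
that multiplication factors through a finite free module. -/
theorem exists_smul_eq_sum_smul (A : Type*) [CommRing A] [IsDomain A] (N : Type*) [AddCommGroup N]
    [Module A N] [Module.Finite A N] :
    ∃ (c : A) (_ : c ≠ 0) (ι : Type) (_ : Fintype ι) (π : ι → N →ₗ[A] A) (b : ι → N),
      ∀ x, c • x = ∑ i, π i x • b i := by
  classical
  obtain ⟨n, s, hs⟩ := Module.Finite.exists_fin (R := A) (M := N)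
  -- By maximality each generator has a nonzero multiple in the span of the independent ones; the
  -- product of these multipliers serves as `c`.
  obtain ⟨I, hI, hI'⟩ := exists_maximal_linearIndepOn A s
  have key : ∀ i, ∃ a : A, a ≠ 0 ∧ a • s i ∈ Submodule.span A (s '' I) := by
    intro i
    by_cases hi : i ∈ I
    · exact ⟨1, one_ne_zero, Submodule.smul_mem _ _ (Submodule.subset_span ⟨i, hi, rfl⟩)⟩
    · exact hI' i hi
  choose a ha ha' using key
  have hmem : ∀ x, (∏ i, a i) • x ∈ Submodule.span A (s '' I) := by
    intro x
    have hx : x ∈ Submodule.span A (Set.range s) := hs ▸ Submodule.mem_top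
    induction hx using Submodule.span_induction with
    | mem x hx =>
      obtain ⟨i, rfl⟩ := hx
      rw [← Finset.prod_erase_mul _ _ (Finset.mem_univ i), mul_smul]
      exact Submodule.smul_mem _ _ (ha' i)
    | zero => simp
    | add x y _ _ hx hy => rw [smul_add]; exact add_mem hx hy
    | smul r x _ hx => rw [smul_comm]; exact Submodule.smul_mem _ _ hx
  have hrange : Set.range (fun i : I => s i) = s '' I := by
    ext; simp
  let B := Module.Basis.span hI.linearIndependent
  let ψ : N →ₗ[A] Submodule.span A (Set.range fun i : I => s i) :=
    ((∏ i, a i) • LinearMap.id).codRestrict _ fun x => by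
      rw [hrange]; exact hmem x
  have : Fintype I := Fintype.ofFinite I
  refine ⟨∏ i, a i, Finset.prod_ne_zero_iff.2 fun i _ => ha i, I, inferInstance,
    fun i => B.coord i ∘ₗ ψ, fun i => s i, fun x => ?_⟩
  have h1 := congrArg Subtype.val (B.sum_repr (ψ x))
  have h2 : ((ψ x : _) : N) = (∏ i, a i) • x := rfl
  rw [h2] at h1
  rw [← h1, AddSubmonoidClass.coe_finsetSum]
  refine Finset.sum_congr rfl fun i _ => ?_
  simp [B, Module.Basis.span_apply]

/-- An additive endomorphism of `R` is `p⁻ᵉ`-linear. -/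
def IsCartierMap (p e : ℕ) {R : Type u} [CommRing R] (φ : R →+ R) : Prop :=
  ∀ r x, φ (r ^ p ^ e * x) = r * φ x

variable {p : ℕ} {R : Type u} [CommRing R]

theorem IsCartierMap.comp {e f : ℕ} {φ ψ : R →+ R} (hφ : IsCartierMap p e φ)
    (hψ : IsCartierMap p f ψ) : IsCartierMap p (e + f) (φ.comp ψ) := fun r x => by
  rw [AddMonoidHom.comp_apply, pow_add, pow_mul, hψ, hφ, AddMonoidHom.comp_apply]

theorem isCartierMap_mulLeft (c : R) : IsCartierMap p 0 (AddMonoidHom.mulLeft c) := fun r x => by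
  simp only [pow_zero, pow_one, AddMonoidHom.coe_mulLeft]
  ring

theorem IsCartierMap.mulLeft_comp {e : ℕ} {φ : R →+ R} (hφ : IsCartierMap p e φ) (c : R) :
    IsCartierMap p e ((AddMonoidHom.mulLeft c).comp φ) := by
  simpa using (isCartierMap_mulLeft c).comp hφ

/-- The values at `d` of all `p⁻ᵉ`-linear endomorphisms of `R`. -/
def cartierIdeal (p e : ℕ) (d : R) : Ideal R where
  carrier := {y | ∃ φ : R →+ R, IsCartierMap p e φ ∧ φ d = y}
  zero_mem' := ⟨0, fun r x => by simp, rfl⟩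
  add_mem' := by
    rintro _ _ ⟨φ, hφ, rfl⟩ ⟨ψ, hψ, rfl⟩
    exact ⟨φ + ψ, fun r x => by
      rw [AddMonoidHom.add_apply, hφ, hψ, AddMonoidHom.add_apply, mul_add], rfl⟩
  smul_mem' := by
    rintro r _ ⟨φ, hφ, rfl⟩
    exact ⟨_, hφ.mulLeft_comp r, rfl⟩

/-- The Frobenius of an `F`-finite domain is free up to multiplication by a nonzero element. -/
theorem exists_cartier_decomposition (p : ℕ) (R : Type u) [CommRing R] [IsDomain R] [ExpChar R p]
    (hR : IsFFinite p R) :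
    ∃ (c : R) (_ : c ≠ 0) (ι : Type) (_ : Fintype ι) (π : ι → R →+ R) (b : ι → R),
      (∀ i, IsCartierMap p 1 (π i)) ∧ ∀ x, c ^ p * x = ∑ i, π i x ^ p * b i := by
  have : Module.Finite R (FrobeniusPower p 1 R) := by
    have h : iterateFrobenius R p 1 = frobenius R p := by
      ext; simp [frobenius_def]
    have h2 : (iterateFrobenius R p 1).Finite := by rw [h]; exact hR
    exact h2
  obtain ⟨c, hc, ι, _, π, b, h⟩ := exists_smul_eq_sum_smul R (FrobeniusPower p 1 R)
  let o := FrobeniusPower.of p 1 R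
  have hsmul : ∀ (r : R) (x : R), r • o x = o (r ^ p * x) := fun r x => by
    rw [Algebra.smul_def, FrobeniusPower.algebraMap_eq, pow_one, ← map_mul]
  refine ⟨c, hc, ι, inferInstance, fun i => (π i).toAddMonoidHom.comp o.toAddMonoidHom,
    fun i => o.symm (b i), fun i r x => ?_, fun x => ?_⟩
  · change π i (o _) = r * π i (o x)
    rw [pow_one, ← hsmul, map_smul, smul_eq_mul]
  · apply o.injective
    rw [← hsmul, h, map_sum]
    refine Finset.sum_congr rfl fun i _ => ?_
    rw [← hsmul, RingEquiv.apply_symm_apply]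
    rfl

section Saturation

variable {c : R} {ι : Type} [Fintype ι] {π : ι → R →+ R} {b : ι → R}

/-- Expanding `c ^ p * φ d` along the decomposition produces `p`-th powers of the values `π i (φ
d)`, which lie in the next Cartier ideal; only `p ≥ 2` is needed to land in its square. -/
theorem mul_mem_cartierIdeal_sq (hp : 2 ≤ p) (hπ : ∀ i, IsCartierMap p 1 (π i))
    (h : ∀ x, c ^ p * x = ∑ i, π i x ^ p * b i) {d : R} {e : ℕ} {y : R}
    (hy : y ∈ cartierIdeal p e d) : c ^ p * y ∈ cartierIdeal p (e + 1) d ^ 2 := by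
  obtain ⟨φ, hφ, rfl⟩ := hy
  rw [h]
  refine sum_mem fun i _ => Ideal.mul_mem_right _ _ ?_
  refine Ideal.pow_le_pow_right hp (Ideal.pow_mem_pow ?_ p)
  exact ⟨(π i).comp φ, by rw [add_comm]; exact (hπ i).comp hφ, rfl⟩

/-- The ideal of elements that a power of `c` moves into `J`. -/
def saturation (c : R) (J : Ideal R) : Ideal R where
  carrier := {x | ∃ n : ℕ, c ^ n * x ∈ J}
  zero_mem' := ⟨0, by simp⟩
  add_mem' := by
    rintro x y ⟨m, hm⟩ ⟨n, hn⟩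
    refine ⟨m + n, ?_⟩
    have : c ^ (m + n) * (x + y) = c ^ n * (c ^ m * x) + c ^ m * (c ^ n * y) := by ring
    rw [this]
    exact add_mem (Ideal.mul_mem_left _ _ hm) (Ideal.mul_mem_left _ _ hn)
  smul_mem' := by
    rintro r x ⟨n, hn⟩
    refine ⟨n, ?_⟩
    rw [smul_eq_mul, mul_left_comm]
    exact Ideal.mul_mem_left _ _ hn

theorem le_saturation (c : R) (J : Ideal R) : J ≤ saturation c J := fun x hx => ⟨0, by simpa⟩

/-- A finitely generated nonzero ideal `K` of a domain with `c K ⊆ K²` contains a power of `c`. -/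
theorem exists_pow_mem_of_smul_le_sq [IsDomain R] {c : R} {K : Ideal R} (hK : K.FG) (hK0 : K ≠ ⊥)
    (h : ∀ x ∈ K, c * x ∈ K ^ 2) : ∃ n : ℕ, c ^ n ∈ K := by
  have : Module.Finite R K := Module.Finite.iff_fg.2 hK
  let f : K →ₗ[R] K := c • LinearMap.id
  have hf : LinearMap.range f ≤ K • (⊤ : Submodule R K) := by
    rintro _ ⟨x, rfl⟩
    have h1 : c * (x : R) ∈ (K • (⊤ : Submodule R K)).map K.subtype := by
      rw [Submodule.map_smul'', Submodule.map_top, Submodule.range_subtype, smul_eq_mul, ← pow_two]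
      exact h x x.2
    obtain ⟨y, hy, hyx⟩ := h1
    have : f x = y := Subtype.ext hyx.symm
    rwa [this]
  -- Determinant trick: `c` is a root of a monic polynomial whose lower coefficients lie in `K`, so
  -- its leading power lies in `K`.
  obtain ⟨q, hq, -, hcoeff, haeval⟩ :=
    LinearMap.exists_monic_and_natDegree_eq_and_coeff_mem_pow_and_aeval_eq_zero R f K hf
  refine ⟨q.natDegree, ?_⟩
  obtain ⟨x, hx, hx0⟩ := K.ne_bot_iff.1 hK0
  have hpow : ∀ (n : ℕ) (y : K), (f ^ n) y = c ^ n • y := by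
    intro n
    induction n with
    | zero => simp
    | succ n ih =>
      intro y
      rw [pow_succ', Module.End.mul_apply, ih]
      simp [f, pow_succ, mul_smul]
  have h0 : q.eval c = 0 := by
    have h1 := congrArg Subtype.val (LinearMap.congr_fun haeval ⟨x, hx⟩)
    rw [Polynomial.aeval_eq_sum_range] at h1
    simp only [LinearMap.sum_apply, LinearMap.smul_apply, hpow, LinearMap.zero_apply,
      AddSubmonoidClass.coe_finsetSum, Submodule.coe_smul, smul_eq_mul, ZeroMemClass.coe_zero] at h1
    rw [Polynomial.eval_eq_sum_range]
    refine (mul_eq_zero.1 (?_ : _ * x = 0)).resolve_right hx0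
    rw [Finset.sum_mul, ← h1]
    exact Finset.sum_congr rfl fun i _ => by ring
  rw [Polynomial.eval_eq_sum_range, Finset.sum_range_succ, hq.coeff_natDegree, one_mul] at h0
  rw [eq_neg_of_add_eq_zero_right h0]
  refine neg_mem (sum_mem fun i hi => Ideal.mul_mem_right _ _ ?_)
  have hi' : i < q.natDegree := Finset.mem_range.1 hi
  exact Ideal.pow_le_self (by omega) (hcoeff i)

/-- The Cartier ideals, saturated at `c`, form an ascending chain. Once it is stable with value `K`,
the previous containment reads `c ^ N * K ⊆ K ^ 2`, and the determinant trick puts a power of `c` in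
`K`. The exponent depends on `d` and `e`. -/
theorem exists_pow_mem_cartierIdeal [IsDomain R] [IsNoetherianRing R] (hp : 2 ≤ p)
    (hπ : ∀ i, IsCartierMap p 1 (π i)) (h : ∀ x, c ^ p * x = ∑ i, π i x ^ p * b i) {d : R}
    (hd : d ≠ 0) : ∃ e₀ : ℕ, ∀ e ≥ e₀, ∃ n : ℕ, c ^ n ∈ cartierIdeal p e d := by
  let K : ℕ → Ideal R := fun e => saturation c (cartierIdeal p e d)
  have hstep : ∀ e, ∀ x ∈ K e, ∃ n : ℕ, c ^ n * x ∈ K (e + 1) ^ 2 := by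
    rintro e x ⟨n, hn⟩
    refine ⟨p + n, ?_⟩
    rw [pow_add, mul_assoc]
    exact Ideal.pow_right_mono (le_saturation _ _) 2 (mul_mem_cartierIdeal_sq hp hπ h hn)
  have hmono : Monotone K := monotone_nat_of_le_succ fun e x hx => by
    obtain ⟨n, hn⟩ := hx
    refine ⟨p + n, ?_⟩
    rw [pow_add, mul_assoc]
    exact Ideal.pow_le_self two_ne_zero (mul_mem_cartierIdeal_sq hp hπ h hn)
  classical
  obtain ⟨e₀, he₀⟩ := monotone_stabilizes_iff_noetherian.2 ‹IsNoetherianRing R› ⟨K, hmono⟩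
  refine ⟨e₀, fun e he => ?_⟩
  have hKe : K (e + 1) = K e := (he₀ (e + 1) (by omega)).symm.trans (he₀ e he)
  have hdK : d ∈ K e := hmono (Nat.zero_le e) (le_saturation _ _ ⟨AddMonoidHom.id R, fun r x => by
    simp, rfl⟩)
  have hfg : (K e).FG := IsNoetherian.noetherian _
  have hN : ∃ N : ℕ, ∀ x ∈ K e, c ^ N * x ∈ K e ^ 2 := by
    obtain ⟨s, hs⟩ := hfg
    have h1 : ∀ x : s, ∃ n : ℕ, c ^ n * (x : R) ∈ K e ^ 2 := fun x => by
      rw [← hKe]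
      exact hstep e x (hs ▸ Submodule.subset_span x.2)
    choose n hn using h1
    refine ⟨∑ x, n x, fun x hx => ?_⟩
    rw [← hs] at hx
    induction hx using Submodule.span_induction with
    | mem x hx =>
      rw [← Finset.sum_erase_add _ _ (Finset.mem_univ (⟨x, hx⟩ : s)), pow_add, mul_assoc]
      exact Ideal.mul_mem_left _ _ (hn ⟨x, hx⟩)
    | zero => simp
    | add x y _ _ hx hy => rw [mul_add]; exact add_mem hx hy
    | smul r x _ hx => rw [smul_eq_mul, mul_left_comm]; exact Ideal.mul_mem_left _ _ hx
  obtain ⟨N, hN⟩ := hN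
  obtain ⟨m, k, hk⟩ := exists_pow_mem_of_smul_le_sq hfg
    ((Submodule.ne_bot_iff _).2 ⟨d, hdK, hd⟩) hN
  refine ⟨k + N * m, ?_⟩
  rwa [pow_add, pow_mul]

end Saturation

/-- A strong form of the existence of test elements in an `F`-finite domain. -/
theorem exists_cartier_test_element (p : ℕ) [Fact p.Prime] (R : Type u) [CommRing R] [IsDomain R]
    [IsNoetherianRing R] [ExpChar R p] (hR : IsFFinite p R) :
    ∃ C : R, C ≠ 0 ∧ ∀ d : R, d ≠ 0 → ∀ e₀ : ℕ, ∃ e ≥ e₀, ∃ φ : R →+ R,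
      IsCartierMap p e φ ∧ φ d = C := by
  have hp : 2 ≤ p := (Fact.out : p.Prime).two_le
  obtain ⟨c, hc, ι, _, π, b, hπ, h⟩ := exists_cartier_decomposition p R hR
  obtain ⟨θ, hθ, hθ1⟩ : c ^ p ∈ cartierIdeal p 1 (1 : R) := by
    have h1 : (1 : R) ∈ cartierIdeal p 0 (1 : R) := ⟨AddMonoidHom.id R, fun r x => by simp, rfl⟩
    have := Ideal.pow_le_self two_ne_zero (mul_mem_cartierIdeal_sq hp hπ h h1)
    rwa [mul_one, zero_add] at this
  set g := c ^ p with hg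
  -- Multiplying by `g ^ (p - 2)` before each `θ` stops the value at `1` from growing: `θ (g ^ (p -
  -- 2) * g ^ 2) = g * θ 1 = g ^ 2`.
  have hθf : ∀ f : ℕ, ∃ ψ : R →+ R, IsCartierMap p f ψ ∧ ψ 1 = g ^ 2 := by
    intro f
    induction f with
    | zero => exact ⟨_, isCartierMap_mulLeft (g ^ 2), by simp⟩
    | succ f ih =>
      obtain ⟨ψ, hψ, hψ1⟩ := ih
      refine ⟨θ.comp ((AddMonoidHom.mulLeft (g ^ (p - 2))).comp ψ), ?_, ?_⟩
      · rw [add_comm]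
        exact hθ.comp (hψ.mulLeft_comp _)
      · have h2 : g ^ (p - 2) * g ^ 2 = g ^ p ^ 1 * 1 := by
          rw [← pow_add, pow_one, mul_one]; congr 1; omega
        rw [AddMonoidHom.comp_apply, AddMonoidHom.comp_apply, hψ1, AddMonoidHom.coe_mulLeft, h2,
          hθ, hθ1, pow_two]
  refine ⟨g ^ 3, pow_ne_zero _ (pow_ne_zero _ hc), fun d hd e₀ => ?_⟩
  obtain ⟨e₁, he₁⟩ := exists_pow_mem_cartierIdeal hp hπ h hd
  obtain ⟨n, hn⟩ := he₁ (max e₀ e₁) (le_max_right _ _)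
  obtain ⟨φ, hφ, hφd⟩ : g ^ p ^ n ∈ cartierIdeal p (max e₀ e₁) d := by
    have hle : n ≤ p * p ^ n := (Nat.lt_pow_self hp).le.trans (Nat.le_mul_of_pos_left _ (by omega))
    rw [hg, ← pow_mul, ← Nat.sub_add_cancel hle, pow_add]
    exact Ideal.mul_mem_left _ _ hn
  -- A `p⁻ⁿ`-linear map turns the factor `g ^ p ^ n` into `g`, so the final value `g ^ 3` no longer
  -- depends on `n`.
  obtain ⟨ψ, hψ, hψ1⟩ := hθf n
  refine ⟨n + max e₀ e₁, le_add_left (le_max_left _ _), ψ.comp φ, hψ.comp hφ, ?_⟩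
  rw [AddMonoidHom.comp_apply, hφd, ← mul_one (g ^ p ^ n), hψ, hψ1]
  ring

end Cartier

/-! ### A nonzero annihilator of the finitistic tight closure of zero. -/

section TestElement

variable {p : ℕ} {R : Type u} [CommRing R] [ExpChar R p] {M : Type v} [AddCommGroup M] [Module R M]

theorem frobeniusImage_bot (e : ℕ) : frobeniusImage p e (⊥ : Submodule R M) = ⊥ := by
  rw [frobeniusImage, LinearMap.range_eq_bot]
  ext x
  rw [Subsingleton.elim x 0]
  simp

theorem mem_tightClosure_bot {m : M} : m ∈ tightClosure p (⊥ : Submodule R M) ↔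
    ∃ c ∈ minimalPrimesCompl R, ∃ e₀ : ℕ, ∀ e ≥ e₀, FrobeniusPower.of p e R c ⊗ₜ[R] m = 0 := by
  change (∃ c ∈ minimalPrimesCompl R, ∃ e₀ : ℕ, ∀ e ≥ e₀,
    FrobeniusPower.of p e R c ⊗ₜ[R] m ∈ frobeniusImage p e (⊥ : Submodule R M)) ↔ _
  simp only [frobeniusImage_bot, Submodule.mem_bot]

theorem mem_finitisticTightClosure_bot {m : M} :
    m ∈ finitisticTightClosure p (⊥ : Submodule R M) ↔
      ∃ M' : Submodule R M, M'.FG ∧ ∃ hm : m ∈ M', (⟨m, hm⟩ : M') ∈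
        tightClosure p (⊥ : Submodule R M') := by
  have h : ∀ M' : Submodule R M, (⊥ : Submodule R M).comap M'.subtype = ⊥ := fun M' => by
    rw [Submodule.comap_bot, Submodule.ker_subtype]
  change (∃ M' : Submodule R M, M'.FG ∧ ∃ hm : m ∈ M', (⟨m, hm⟩ : M') ∈
    tightClosure p ((⊥ : Submodule R M).comap M'.subtype)) ↔ _
  simp only [h]

/-- `φ` is an `R`-linear map `R^e → R`; tensored with `M` it sends `d ⊗ m` to `φ d • m`. -/
theorem IsCartierMap.smul_eq_zero {e : ℕ} {φ : R →+ R} (hφ : IsCartierMap p e φ) {d : R} {m : M}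
    (h : FrobeniusPower.of p e R d ⊗ₜ[R] m = 0) : φ d • m = 0 := by
  let o := FrobeniusPower.of p e R
  let φ' : FrobeniusPower p e R →ₗ[R] R :=
    { toFun := fun x => φ (o.symm x)
      map_add' := fun x y => by rw [map_add, map_add]
      map_smul' := fun r x => by
        rw [Algebra.smul_def, FrobeniusPower.algebraMap_eq, map_mul, RingEquiv.symm_apply_apply, hφ]
        rfl }
  have := congrArg (TensorProduct.lid R M ∘ φ'.rTensor M) h
  simpa [φ', o] using this

theorem ne_zero_of_mem_minimalPrimesCompl [IsDomain R] {c : R} (hc : c ∈ minimalPrimesCompl R) :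
    c ≠ 0 := by
  rintro rfl
  exact hc ⊥ (by rw [IsDomain.minimalPrimes_eq_singleton_bot]; rfl) (zero_mem _)

theorem exists_smul_finitisticTightClosure_eq_zero (p : ℕ) [Fact p.Prime] (R : Type u) [CommRing R]
    [IsDomain R] [IsNoetherianRing R] [ExpChar R p] (hR : IsFFinite p R) (M : Type v)
    [AddCommGroup M] [Module R M] :
    ∃ C : R, C ≠ 0 ∧ ∀ m ∈ finitisticTightClosure p (⊥ : Submodule R M), C • m = 0 := by
  obtain ⟨C, hC, h⟩ := exists_cartier_test_element p R hR
  refine ⟨C, hC, fun m hm => ?_⟩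
  obtain ⟨M', -, hm', ht⟩ := mem_finitisticTightClosure_bot.1 hm
  obtain ⟨d, hd, e₀, hd'⟩ := mem_tightClosure_bot.1 ht
  obtain ⟨e, he, φ, hφ, rfl⟩ := h d (ne_zero_of_mem_minimalPrimesCompl hd) e₀
  exact congrArg Subtype.val (hφ.smul_eq_zero (hd' e he))

end TestElement

/-! ### Consequences of injectivity. -/

section Injective

/-- A linear map to a Baer module that vanishes on the kernel of `α` factors through `α`. -/
theorem _root_.Module.Baer.exists_comp_eq_of_ker_le {R : Type*} [CommRing R] {E N P : Type*}
    [AddCommGroup E] [Module R E] [AddCommGroup N] [Module R N] [AddCommGroup P] [Module R P]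
    (hE : Module.Baer R E) (α : N →ₗ[R] P) (β : N →ₗ[R] E)
    (h : LinearMap.ker α ≤ LinearMap.ker β) : ∃ γ : P →ₗ[R] E, γ ∘ₗ α = β := by
  obtain ⟨γ, hγ⟩ := hE.extension_property ((LinearMap.ker α).liftQ α le_rfl)
    (LinearMap.ker_eq_bot.1 (Submodule.ker_liftQ_eq_bot _ _ _ le_rfl))
    ((LinearMap.ker α).liftQ β h)
  refine ⟨γ, LinearMap.ext fun x => ?_⟩
  simpa using LinearMap.congr_fun hγ (Submodule.Quotient.mk x)

theorem IsInjectiveHull.baer {R : Type u} [CommRing R] {M E : Type u} [AddCommGroup M] [Module R M]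
    [AddCommGroup E] [Module R E] {i : M →ₗ[R] E} (h : IsInjectiveHull R i) : Module.Baer R E :=
  Module.Baer.of_injective h.injective_module

theorem residueHull_baer (R : Type u) [CommRing R] [IsLocalRing R] :
    Module.Baer R (ResidueHull R) :=
  let ⟨_, h⟩ := residueHull_spec R
  h.baer

/-- If `J • x = 0` in `N / Z` whenever `I • x = 0`, then `J` multiplies `Hom(N / Z, E)` into
`I Hom(N / Z, E)`. -/
theorem exists_sum_smul_of_colon_le {R : Type*} [CommRing R] {E M : Type*}
    [AddCommGroup E] [Module R E] [AddCommGroup M] [Module R M] (hE : Module.Baer R E)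
    (Z : Submodule R M) {n : ℕ} (a : Fin n → R) (f : M →ₗ[R] E)
    (h : ∀ z, (∀ i, a i • z ∈ Z) → f z = 0) :
    ∃ g : Fin n → M →ₗ[R] E, (∀ i, ∀ z ∈ Z, g i z = 0) ∧ f = ∑ i, a i • g i := by
  -- The kernel of `α` is `(Z : I)`, with `I` generated by the `a i`; the `g i` are the components
  -- of an extension of `f` over `α`.
  let α : M →ₗ[R] (Fin n → M ⧸ Z) := LinearMap.pi fun i => a i • Z.mkQ
  obtain ⟨γ, hγ⟩ := hE.exists_comp_eq_of_ker_le α f (fun z hz => h z fun i => by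
    have := congrFun (LinearMap.mem_ker.1 hz) i
    rwa [LinearMap.pi_apply, LinearMap.smul_apply, ← map_smul, Pi.zero_apply, Submodule.mkQ_apply,
      Submodule.Quotient.mk_eq_zero] at this)
  refine ⟨fun i => γ ∘ₗ LinearMap.single R _ i ∘ₗ Z.mkQ, fun i z hz => ?_, ?_⟩
  · rw [LinearMap.comp_apply, LinearMap.comp_apply, Submodule.mkQ_apply,
      (Submodule.Quotient.mk_eq_zero Z).2 hz, map_zero, map_zero]
  · ext z
    rw [← hγ, LinearMap.comp_apply, ← Finset.univ_sum_single (α z), map_sum, LinearMap.sum_apply]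
    refine Finset.sum_congr rfl fun i _ => ?_
    change γ (Pi.single i (a i • Z.mkQ z)) = a i • γ (Pi.single i (Z.mkQ z))
    rw [Pi.single_smul, map_smul]

end Injective

/-! ### The strong test module property. -/

section Strong

variable {p : ℕ} {R : Type u} [CommRing R] [ExpChar R p] {M : Type v} [AddCommGroup M] [Module R M]

theorem le_tightClosure (N : Submodule R M) : N ≤ tightClosure p N := fun x hx =>
  ⟨1, one_mem _, 0, fun e _ => ⟨FrobeniusPower.of p e R 1 ⊗ₜ ⟨x, hx⟩, by simp⟩⟩

/-- Membership in the tight closure of an ideal, in terms of bracket powers. -/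
theorem exists_mul_pow_mem_of_mem_tightClosure {I : Ideal R} {x : R} (hx : x ∈ tightClosure p I) :
    ∃ c ∈ minimalPrimesCompl R, ∃ e₀ : ℕ, ∀ e ≥ e₀,
      c * x ^ p ^ e ∈ Ideal.span ((fun y => y ^ p ^ e) '' (I : Set R)) := by
  obtain ⟨c, hc, e₀, h⟩ := hx
  refine ⟨c, hc, e₀, fun e he => ?_⟩
  obtain ⟨y, hy⟩ := h e he
  let o := FrobeniusPower.of p e R
  let μ := Algebra.TensorProduct.rid R (FrobeniusPower p e R) (FrobeniusPower p e R)
  have hμ : ∀ (a : FrobeniusPower p e R) (r : R), μ (a ⊗ₜ r) = a * o (r ^ p ^ e) := fun a r => by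
    rw [Algebra.TensorProduct.rid_tmul, Algebra.smul_def, FrobeniusPower.algebraMap_eq, mul_comm]
  have h1 : o.symm (μ (o c ⊗ₜ x)) = c * x ^ p ^ e := by
    rw [hμ, ← map_mul, RingEquiv.symm_apply_apply]
  rw [← h1, ← hy]
  clear hy h1
  induction y using TensorProduct.induction_on with
  | zero => simp
  | add y z hy hz => rw [map_add, map_add, map_add]; exact add_mem hy hz
  | tmul a r =>
    rw [LinearMap.baseChange_tmul, hμ, map_mul, RingEquiv.symm_apply_apply]
    exact Ideal.mul_mem_left _ _ (Ideal.subset_span ⟨r, r.2, rfl⟩)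

/-- If `I z` lies in the tight closure of zero, then so does `I^* z`. -/
theorem tightClosure_smul_mem {I : Ideal R} (hI : I.FG) {z : M}
    (hz : ∀ a ∈ I, a • z ∈ tightClosure p (⊥ : Submodule R M)) {x : R}
    (hx : x ∈ tightClosure p I) : x • z ∈ tightClosure p (⊥ : Submodule R M) := by
  classical
  -- One multiplier and one bound serve all of `I`: take them over finitely many generators and use
  -- additivity of Frobenius.
  have hunif : ∃ c ∈ minimalPrimesCompl R, ∃ e₀ : ℕ, ∀ e ≥ e₀, ∀ a ∈ I,
      FrobeniusPower.of p e R (c * a ^ p ^ e) ⊗ₜ[R] z = 0 := by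
    obtain ⟨s, rfl⟩ := hI
    choose! c hc e₀ h using fun a (ha : a ∈ s) =>
      mem_tightClosure_bot.1 (hz a (Submodule.subset_span ha))
    refine ⟨∏ a ∈ s, c a, prod_mem fun a ha => hc a ha, s.sup e₀, fun e he a ha => ?_⟩
    induction ha using Submodule.span_induction with
    | mem a ha =>
      have h1 := h a ha e ((Finset.le_sup (f := e₀) ha).trans he)
      rw [← TensorProduct.smul_tmul, Algebra.smul_def, FrobeniusPower.algebraMap_eq, ← map_mul]
        at h1
      have h2 := congrArg (fun t => FrobeniusPower.of p e R (∏ a ∈ s.erase a, c a) • t) h1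
      rw [smul_zero, TensorProduct.smul_tmul', smul_eq_mul, ← map_mul] at h2
      rw [← h2, ← Finset.prod_erase_mul s c ha]
      congr 2
      ring
    | zero => rw [zero_pow (pow_ne_zero _ (expChar_pos R p).ne'), mul_zero, map_zero,
        TensorProduct.zero_tmul]
    | add a b _ _ ha hb => rw [add_pow_expChar_pow, mul_add, map_add, TensorProduct.add_tmul, ha,
        hb, add_zero]
    | smul r a _ ha =>
      rw [smul_eq_mul, mul_pow, mul_left_comm, map_mul, ← smul_eq_mul, ← TensorProduct.smul_tmul',
        ha, smul_zero]
  obtain ⟨c, hc, e₀, h⟩ := hunif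
  obtain ⟨d, hd, e₁, hd'⟩ := exists_mul_pow_mem_of_mem_tightClosure hx
  refine mem_tightClosure_bot.2 ⟨c * d, mul_mem hc hd, max e₀ e₁, fun e he => ?_⟩
  rw [← TensorProduct.smul_tmul, Algebra.smul_def, FrobeniusPower.algebraMap_eq, ← map_mul]
  have key : ∀ y ∈ Ideal.span ((fun y => y ^ p ^ e) '' (I : Set R)),
      FrobeniusPower.of p e R (c * y) ⊗ₜ[R] z = 0 := by
    intro y hy
    induction hy using Submodule.span_induction with
    | mem y hy =>
      obtain ⟨a, ha, rfl⟩ := hy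
      exact h e (le_of_max_le_left he) a ha
    | zero => rw [mul_zero, map_zero, TensorProduct.zero_tmul]
    | add a b _ _ ha hb => rw [mul_add, map_add, TensorProduct.add_tmul, ha, hb, add_zero]
    | smul r a _ ha => rw [smul_eq_mul, mul_left_comm, map_mul, ← smul_eq_mul,
        ← TensorProduct.smul_tmul', ha, smul_zero]
  rw [← key _ (hd' e (le_of_max_le_right he))]
  congr 2
  ring

theorem finitisticTightClosure_smul_mem [IsNoetherianRing R] {I : Ideal R} {z : M}
    (hz : ∀ a ∈ I, a • z ∈ finitisticTightClosure p (⊥ : Submodule R M)) {x : R}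
    (hx : x ∈ tightClosure p I) : x • z ∈ finitisticTightClosure p (⊥ : Submodule R M) := by
  classical
  have hI : I.FG := IsNoetherian.noetherian I
  obtain ⟨M', hM', hzM', h⟩ : ∃ M' : Submodule R M, M'.FG ∧ ∃ hz : z ∈ M', ∀ a ∈ I,
      a • (⟨z, hz⟩ : M') ∈ tightClosure p (⊥ : Submodule R M') := by
    have hI' := hI
    obtain ⟨s, hs⟩ := hI'
    choose! M' hM' hzM' h using fun a (ha : a ∈ s) =>
      mem_finitisticTightClosure_bot.1 (hz a (hs ▸ Submodule.subset_span ha))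
    -- The witness `M' a` is only known to contain `a • z`, so `z` itself has to be adjoined.
    have hzs : z ∈ Submodule.span R {z} ⊔ s.sup M' :=
      Submodule.mem_sup_left (Submodule.mem_span_singleton_self z)
    refine ⟨Submodule.span R {z} ⊔ s.sup M', (Submodule.fg_span_singleton z).sup
      (Submodule.fg_finset_sup s M' hM'), hzs, fun a ha => ?_⟩
    rw [← hs] at ha
    induction ha using Submodule.span_induction with
    | mem a ha =>
      have hle : M' a ≤ Submodule.span R {z} ⊔ s.sup M' := (Finset.le_sup ha).trans le_sup_right
      exact tightClosure_map p (Submodule.inclusion hle) (N' := ⊥) bot_le (h a ha)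
    | zero => rw [zero_smul]; exact zero_mem _
    | add a b _ _ ha hb => rw [add_smul]; exact add_mem ha hb
    | smul r a _ ha => rw [smul_eq_mul, mul_smul]; exact Submodule.smul_mem _ _ ha
  exact mem_finitisticTightClosure_bot.2
    ⟨M', hM', M'.smul_mem x hzM', tightClosure_smul_mem hI h hx⟩

theorem hasStrongTestModuleProperty_finitisticTestModule (p : ℕ) (R : Type u) [CommRing R]
    [IsLocalRing R] [IsNoetherianRing R] [ExpChar R p] (M : Type v) [AddCommGroup M] [Module R M] :
    HasStrongTestModuleProperty p R (finitisticTestModule p R M) := by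
  intro I
  refine le_antisymm (Submodule.smul_mono_left (le_tightClosure I)) (Submodule.smul_le.2 ?_)
  rintro x hx ⟨f, hf⟩ -
  obtain ⟨n, a, ha⟩ := Submodule.fg_iff_exists_fin_generating_family.1
    (IsNoetherian.noetherian (R := R) I)
  obtain ⟨g, hg, hfg⟩ := exists_sum_smul_of_colon_le (residueHull_baer R)
    (finitisticTightClosure p (⊥ : Submodule R M)) a (x • f) (fun z hz => by
      rw [LinearMap.smul_apply, ← map_smul]
      refine hf _ (finitisticTightClosure_smul_mem (fun b hb => ?_) hx)
      rw [← ha] at hb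
      induction hb using Submodule.span_induction with
      | mem b hb => obtain ⟨i, rfl⟩ := hb; exact hz i
      | zero => rw [zero_smul]; exact zero_mem _
      | add a b _ _ ha hb => rw [add_smul]; exact add_mem ha hb
      | smul r a _ ha => rw [smul_eq_mul, mul_smul]; exact Submodule.smul_mem _ _ ha)
  have : x • (⟨f, hf⟩ : finitisticTestModule p R M) =
      ∑ i, a i • (⟨g i, hg i⟩ : finitisticTestModule p R M) := by
    apply Subtype.ext
    rw [AddSubmonoidClass.coe_finsetSum]
    exact hfg
  rw [this]
  exact sum_mem fun i _ => Submodule.smul_mem_smul (ha ▸ Submodule.subset_span ⟨i, rfl⟩)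
    Submodule.mem_top

end Strong

open IsLocalRing

/-! ### The hull of the residue field: socle, torsion, endomorphisms. -/

section Hull

variable {A : Type u} [CommRing A] [IsLocalRing A] {E : Type u} [AddCommGroup E] [Module A E]
  {i : ResidueField A →ₗ[A] E}

theorem residueField_smul_eq_zero {a : A} (ha : a ∈ maximalIdeal A) (x : ResidueField A) :
    a • x = 0 := by
  rw [Algebra.smul_def, ResidueField.algebraMap_eq, (residue_eq_zero_iff a).2 ha, zero_mul]

/-- By essentiality a nonzero multiple of `y ≠ 0` lies in the residue field, and its multiplier must
be a unit. -/
theorem IsInjectiveHull.mem_range (h : IsInjectiveHull A i) {y : E}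
    (hy : ∀ a ∈ maximalIdeal A, a • y = 0) : y ∈ LinearMap.range i := by
  by_cases hy0 : y = 0
  · rw [hy0]; exact zero_mem _
  have hne : Submodule.span A {y} ⊓ LinearMap.range i ≠ ⊥ := fun hbot =>
    hy0 (Submodule.span_singleton_eq_bot.1 (h.essential _ hbot))
  obtain ⟨z, ⟨hz, hzi⟩, hz0⟩ := Submodule.exists_mem_ne_zero_of_ne_bot hne
  obtain ⟨a, rfl⟩ := Submodule.mem_span_singleton.1 hz
  have ha : IsUnit a := by
    by_contra ha
    exact hz0 (hy a ((mem_maximalIdeal a).2 ha))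
  obtain ⟨a, rfl⟩ := ha
  rw [← inv_smul_smul a y]
  exact Submodule.smul_mem _ ((a⁻¹ : Aˣ) : A) hzi

theorem smul_range_eq_zero {y : E} (hy : y ∈ LinearMap.range i) {a : A}
    (ha : a ∈ maximalIdeal A) : a • y = 0 := by
  obtain ⟨x, rfl⟩ := hy
  rw [← map_smul, residueField_smul_eq_zero ha, map_zero]

/-- The socle of the hull of the residue field is one-dimensional. -/
theorem IsInjectiveHull.exists_eq_smul (h : IsInjectiveHull A i) {y z : E}
    (hy : ∀ a ∈ maximalIdeal A, a • y = 0) (hz : ∀ a ∈ maximalIdeal A, a • z = 0) (hz0 : z ≠ 0) :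
    ∃ s : A, y = s • z := by
  obtain ⟨y, rfl⟩ := h.mem_range hy
  obtain ⟨z, rfl⟩ := h.mem_range hz
  have hz' : z ≠ 0 := fun h0 => hz0 (by rw [h0, map_zero])
  obtain ⟨s, hs⟩ := residue_surjective (y / z)
  refine ⟨s, ?_⟩
  rw [← map_smul, Algebra.smul_def, ResidueField.algebraMap_eq, hs, div_mul_cancel₀ _ hz']

/-- Every element of the hull of the residue field is killed by a power of the maximal ideal. -/
theorem IsInjectiveHull.exists_pow_smul_eq_zero [IsNoetherianRing A] (h : IsInjectiveHull A i)
    (y : E) : ∃ n : ℕ, ∀ a ∈ maximalIdeal A ^ n, a • y = 0 := by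
  let N := Submodule.span A {y}
  let S : Submodule A N := (LinearMap.range i).comap N.subtype
  -- Artin–Rees gives `𝔪^(k+1) N ∩ S ⊆ 𝔪 S = 0`; essentiality then forces `𝔪^(k+1) N = 0`.
  obtain ⟨k, hk⟩ := Ideal.exists_pow_inf_eq_pow_smul (maximalIdeal A) S
  have h1 : maximalIdeal A ^ (k + 1) • (⊤ : Submodule A N) ⊓ S = ⊥ := by
    rw [hk (k + 1) (by omega), eq_bot_iff, Nat.add_sub_cancel_left, pow_one]
    refine Submodule.smul_le.2 fun a ha z hz => ?_
    exact (Submodule.mem_bot A).2 (Subtype.ext (smul_range_eq_zero hz.2 ha))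
  have h2 : (maximalIdeal A ^ (k + 1) • (⊤ : Submodule A N)).map N.subtype = ⊥ := by
    refine h.essential _ (eq_bot_iff.2 ?_)
    rintro _ ⟨⟨z, hz, rfl⟩, hzi⟩
    have : z ∈ maximalIdeal A ^ (k + 1) • (⊤ : Submodule A N) ⊓ S := ⟨hz, hzi⟩
    rw [h1, Submodule.mem_bot] at this
    rw [this]
    exact zero_mem _
  refine ⟨k + 1, fun a ha => ?_⟩
  rw [← Submodule.mem_bot A, ← h2]
  exact ⟨a • ⟨y, Submodule.mem_span_singleton_self y⟩,
    Submodule.smul_mem_smul ha Submodule.mem_top, rfl⟩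

/-- The hull of the residue field detects membership in ideals. -/
theorem IsInjectiveHull.exists_smul_ne_zero (h : IsInjectiveHull A i) {J : Ideal A} {a : A}
    (ha : a ∉ J) : ∃ e : E, (∀ b ∈ J, b • e = 0) ∧ a • e ≠ 0 := by
  obtain ⟨γ, hγ⟩ := h.baer.exists_comp_eq_of_ker_le (LinearMap.toSpanSingleton A (A ⧸ J) (J.mkQ a))
    (i ∘ₗ Algebra.linearMap A (ResidueField A)) (fun x hx => by
      have hx' : x * a ∈ J := by
        rw [LinearMap.mem_ker, LinearMap.toSpanSingleton_apply, ← map_smul, Submodule.mkQ_apply,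
          Submodule.Quotient.mk_eq_zero] at hx
        exact hx
      have hxm : x ∈ maximalIdeal A := by
        rw [mem_maximalIdeal, mem_nonunits_iff]
        exact fun hu => ha ((Ideal.unit_mul_mem_iff_mem J hu).1 hx')
      rw [LinearMap.mem_ker, LinearMap.comp_apply, Algebra.linearMap_apply,
        ResidueField.algebraMap_eq, (residue_eq_zero_iff x).2 hxm, map_zero])
  have hmk : ∀ b, b • γ (J.mkQ 1) = γ (J.mkQ b) := fun b => by
    rw [← map_smul, ← map_smul, smul_eq_mul, mul_one]
  refine ⟨γ (J.mkQ 1), fun b hb => ?_, ?_⟩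
  · rw [hmk, Submodule.mkQ_apply, (Submodule.Quotient.mk_eq_zero J).2 hb, map_zero]
  · have h1 := LinearMap.congr_fun hγ 1
    rw [LinearMap.comp_apply, LinearMap.toSpanSingleton_apply, one_smul, LinearMap.comp_apply,
      Algebra.linearMap_apply, map_one] at h1
    rw [hmk, h1]
    exact fun h0 => one_ne_zero (h.injective (h0.trans (map_zero i).symm))

theorem IsInjectiveHull.eq_of_forall_smul_eq (h : IsInjectiveHull A i) {a b : A}
    (hab : ∀ e : E, a • e = b • e) : a = b := by
  by_contra hne
  obtain ⟨e, -, he⟩ := h.exists_smul_ne_zero (J := ⊥) (a := a - b)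
    (by rwa [Ideal.mem_bot, sub_eq_zero])
  exact he (by rw [sub_smul, hab, sub_self])

/-- On the elements killed by an `𝔪`-primary ideal, an endomorphism of the hull of the residue
field is a multiplication. -/
theorem IsInjectiveHull.exists_eq_smul_of_pow_le [IsNoetherianRing A] (h : IsInjectiveHull A i)
    {n : ℕ} (J : Ideal A) (hJ : maximalIdeal A ^ n ≤ J) (g : E →ₗ[A] E) :
    ∃ a : A, ∀ x : E, (∀ b ∈ J, b • x = 0) → g x = a • x := by
  induction J using WellFoundedGT.induction with
  | ind J ih =>
  classical
  by_cases hJt : J = ⊤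
  · refine ⟨0, fun x hx => ?_⟩
    have : x = 0 := by simpa using hx 1 (hJt ▸ Submodule.mem_top)
    rw [this, map_zero, smul_zero]
  -- `b` represents a nonzero socle element of `A/J`, taken from the last power of `𝔪` not contained
  -- in `J`.
  obtain ⟨b, hbJ, hb⟩ : ∃ b, b ∉ J ∧ ∀ a ∈ maximalIdeal A, a * b ∈ J := by
    have hex : ∃ n, maximalIdeal A ^ n ≤ J := ⟨n, hJ⟩
    obtain ⟨k, hk⟩ : ∃ k, Nat.find hex = k + 1 := Nat.exists_eq_succ_of_ne_zero fun h0 => by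
      have := Nat.find_spec hex
      rw [h0, pow_zero, Ideal.one_eq_top] at this
      exact hJt (top_le_iff.1 this)
    obtain ⟨b, hb, hbJ⟩ := SetLike.not_le_iff_exists.1 (Nat.find_min hex (m := k) (by omega))
    refine ⟨b, hbJ, fun a ha => ?_⟩
    have := Nat.find_spec hex
    rw [hk, pow_succ'] at this
    exact this (Ideal.mul_mem_mul ha hb)
  let J' := J ⊔ Ideal.span {b}
  have hlt : J < J' := lt_of_le_of_ne le_sup_left fun heq => hbJ (by
    rw [heq]; exact Ideal.mem_sup_right (Ideal.mem_span_singleton_self b))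
  obtain ⟨a, ha⟩ := ih J' hlt (hJ.trans hlt.le)
  have hJ' : ∀ x : E, (∀ c ∈ J, c • x = 0) → b • x = 0 → g x = a • x := fun x hx hbx =>
    ha x fun c hc => by
      obtain ⟨c, hcJ, d, hd, rfl⟩ := Submodule.mem_sup.1 hc
      obtain ⟨d, rfl⟩ := Ideal.mem_span_singleton'.1 hd
      rw [add_smul, hx c hcJ, mul_smul, hbx, smul_zero, add_zero]
  obtain ⟨e, heJ, heb⟩ := h.exists_smul_ne_zero hbJ
  have hsoc : ∀ x : E, (∀ c ∈ J, c • x = 0) → ∀ c ∈ maximalIdeal A, c • b • x = 0 :=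
    fun x hx c hc => by rw [← mul_smul, hx _ (hb c hc)]
  -- The error of `a` at `e` is a socle element, hence a multiple of `b • e`. Adding `s * b` to `a`
  -- corrects it without changing the action on elements killed by `b`.
  obtain ⟨s, hs⟩ := h.exists_eq_smul (y := g e - a • e) (fun c hc => by
    rw [smul_sub, ← map_smul, smul_comm, sub_eq_zero]
    refine hJ' _ (fun d hd => ?_) ?_
    · rw [smul_comm, heJ d hd, smul_zero]
    · rw [smul_comm, hsoc e heJ c hc]) (hsoc e heJ) heb
  refine ⟨a + s * b, fun x hx => ?_⟩
  obtain ⟨r, hr⟩ := h.exists_eq_smul (hsoc x hx) (hsoc e heJ) heb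
  have h1 := hJ' (x - r • e)
    (fun c hc => by rw [smul_sub, hx c hc, smul_comm, heJ c hc, smul_zero, sub_zero])
    (by rw [smul_sub, hr, smul_comm, sub_self])
  rw [map_sub, map_smul, sub_eq_iff_eq_add, sub_eq_iff_eq_add.1 hs] at h1
  rw [h1, add_smul, mul_smul, hr, smul_sub, smul_add, smul_comm s r, smul_comm a r]
  abel

/-- Over a complete Noetherian local ring every endomorphism of the hull of the residue field is a
multiplication. -/
theorem IsInjectiveHull.exists_forall_eq_smul [IsNoetherianRing A]
    [IsPrecomplete (maximalIdeal A) A] (h : IsInjectiveHull A i) (g : E →ₗ[A] E) :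
    ∃ a : A, ∀ x : E, g x = a • x := by
  choose a ha using fun n => h.exists_eq_smul_of_pow_le (maximalIdeal A ^ n) le_rfl g
  -- Both scalars act as `g` on the elements killed by `𝔪^m`, and these detect membership in `𝔪^m`.
  have hmem : ∀ {m n : ℕ}, m ≤ n → a m - a n ∈ maximalIdeal A ^ m := by
    intro m n hmn
    by_contra hne
    obtain ⟨e, he, hae⟩ := h.exists_smul_ne_zero hne
    refine hae ?_
    rw [sub_smul, ← ha m e he, ← ha n e fun b hb => he b (Ideal.pow_le_pow_right hmn hb), sub_self]
  obtain ⟨L, hL⟩ := IsPrecomplete.prec ‹_› (f := a) fun hmn => by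
    rw [SModEq.sub_mem, smul_eq_mul, Ideal.mul_top]
    exact hmem hmn
  refine ⟨L, fun x => ?_⟩
  obtain ⟨n, hn⟩ := h.exists_pow_smul_eq_zero x
  have h1 := hL n
  rw [SModEq.sub_mem, smul_eq_mul, Ideal.mul_top] at h1
  have h2 := hn _ h1
  rw [sub_smul, sub_eq_zero] at h2
  rw [ha n x hn, h2]

end Hull

/-! ### Finite local extensions and descent of completeness. -/

section Finite

variable (A : Type u) (R : Type v) [CommRing A] [IsLocalRing A] [CommRing R] [IsLocalRing R]
  [Algebra A R] [Module.Finite A R]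

theorem comap_maximalIdeal_of_finite : (maximalIdeal R).comap (algebraMap A R) = maximalIdeal A :=
  eq_maximalIdeal (Ideal.isMaximal_comap_of_isIntegral_of_isMaximal (maximalIdeal R))

theorem isLocalHom_algebraMap_of_finite : IsLocalHom (algebraMap A R) :=
  ((local_hom_TFAE (algebraMap A R)).out 0 4).2 (comap_maximalIdeal_of_finite A R)

/-- By integrality, a prime over the extended ideal contracts to the maximal ideal of `A`, so it is
the maximal ideal of `R`. -/
theorem exists_pow_maximalIdeal_le_map [IsNoetherianRing R] (n : ℕ) :
    ∃ N : ℕ, maximalIdeal R ^ N ≤ (maximalIdeal A ^ n).map (algebraMap A R) := by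
  refine Ideal.exists_pow_le_of_le_radical_of_fg ?_ (IsNoetherian.noetherian _)
  rw [Ideal.radical_eq_sInf]
  refine le_sInf fun P hP => ?_
  have hPp : P.IsPrime := hP.2
  have h1 : maximalIdeal A ≤ P.comap (algebraMap A R) :=
    Ideal.IsPrime.le_of_pow_le (n := n) (Ideal.map_le_iff_le_comap.1 hP.1)
  have h2 : (P.comap (algebraMap A R)).IsMaximal := by
    rw [← (maximalIdeal.isMaximal A).eq_of_le (Ideal.comap_ne_top _ hPp.ne_top) h1]
    infer_instance
  exact (eq_maximalIdeal (Ideal.isMaximal_of_isIntegral_of_isMaximal_comap P h2)).ge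

/-- A Noetherian local subring over which a complete local ring is finite is complete. -/
theorem isPrecomplete_of_finite [IsNoetherianRing A] [IsNoetherianRing R]
    [IsPrecomplete (maximalIdeal R) R] (hAR : Function.Injective (algebraMap A R)) :
    IsPrecomplete (maximalIdeal A) A := by
  refine ⟨fun f hf => ?_⟩
  have hf' : ∀ {m n : ℕ}, m ≤ n → f m - f n ∈ maximalIdeal A ^ m := fun hmn => by
    have := hf hmn
    rwa [SModEq.sub_mem, smul_eq_mul, Ideal.mul_top] at this
  have hpow : ∀ (n : ℕ) {a : A}, a ∈ maximalIdeal A ^ n → algebraMap A R a ∈ maximalIdeal R ^ n := by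
    intro n a ha
    have h1 : (maximalIdeal A).map (algebraMap A R) ≤ maximalIdeal R :=
      Ideal.map_le_iff_le_comap.2 (comap_maximalIdeal_of_finite A R).ge
    have h2 := Ideal.mem_map_of_mem (algebraMap A R) ha
    rw [Ideal.map_pow] at h2
    exact Ideal.pow_right_mono h1 n h2
  obtain ⟨r, hr⟩ := IsPrecomplete.prec ‹IsPrecomplete (maximalIdeal R) R›
    (f := fun n => algebraMap A R (f n)) fun {m n} hmn => by
      rw [SModEq.sub_mem, smul_eq_mul, Ideal.mul_top, ← map_sub]
      exact hpow m (hf' hmn)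
  have hr' : ∀ n, algebraMap A R (f n) - r ∈ maximalIdeal R ^ n := fun n => by
    have := hr n
    rwa [SModEq.sub_mem, smul_eq_mul, Ideal.mul_top] at this
  have hlim : ∀ n : ℕ, ∃ N ≥ n, algebraMap A R (f N) - r ∈
      maximalIdeal A ^ n • (⊤ : Submodule A R) := fun n => by
    obtain ⟨N, hN⟩ := exists_pow_maximalIdeal_le_map A R n
    refine ⟨max n N, le_max_left _ _, ?_⟩
    rw [Ideal.smul_top_eq_map]
    exact hN (Ideal.pow_le_pow_right (le_max_right _ _) (hr' (max n N)))
  let S : Submodule A R := LinearMap.range (Algebra.linearMap A R)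
  -- The limit in `R` lies in the image of `A` because the finite `A`-module `R/S` is separated
  -- (Krull).
  obtain ⟨a, rfl⟩ : r ∈ S := by
    rw [← Submodule.Quotient.mk_eq_zero, ← Submodule.mem_bot A,
      ← Ideal.iInf_pow_smul_eq_bot_of_isLocalRing (maximalIdeal A) Ideal.IsPrime.ne_top',
      Submodule.mem_iInf]
    intro n
    obtain ⟨N, -, hN⟩ := hlim n
    have h1 : S.mkQ (algebraMap A R (f N) - r) = - Submodule.Quotient.mk r := by
      have h0 : S.mkQ (algebraMap A R (f N)) = 0 := (Submodule.Quotient.mk_eq_zero S).2 ⟨f N, rfl⟩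
      rw [map_sub, h0, zero_sub, Submodule.mkQ_apply]
    rw [← neg_mem_iff, ← h1]
    have h2 := Submodule.mem_map_of_mem (f := S.mkQ) hN
    rw [Submodule.map_smul''] at h2
    exact Submodule.smul_mono le_rfl le_top h2
  -- Artin–Rees turns convergence inside `R` into convergence for the `𝔪`-adic topology of `A`, with
  -- shift `k`.
  obtain ⟨k, hk⟩ := Ideal.exists_pow_inf_eq_pow_smul (maximalIdeal A) S
  refine ⟨a, fun n => ?_⟩
  rw [SModEq.sub_mem, smul_eq_mul, Ideal.mul_top]
  obtain ⟨N, hnN, hN⟩ := hlim (n + k)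
  have h1 : algebraMap A R (f N - a) ∈ maximalIdeal A ^ (n + k) • (⊤ : Submodule A R) ⊓ S :=
    ⟨by rw [map_sub]; exact hN, ⟨f N - a, rfl⟩⟩
  rw [hk (n + k) (by omega), Nat.add_sub_cancel] at h1
  have h2 := Submodule.smul_mono (le_refl (maximalIdeal A ^ n)) inf_le_right h1
  rw [show S = _ from LinearMap.range_eq_map _, ← Submodule.map_smul'', smul_eq_mul, Ideal.mul_top] at h2
  obtain ⟨b, hb, hb'⟩ := h2
  rw [← sub_add_sub_cancel (f n) (f N) a, ← hAR hb']
  exact add_mem (hf' (by omega)) hb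

end Finite

/-! ### The coinduced module `Hom_A(R, E)` and the residue trace. -/

section Coinduced

/-- The `A`-linear maps `R → E`, seen as an `R`-module through the source. -/
def Coinduced (A R E : Type*) [CommRing A] [CommRing R] [Algebra A R] [AddCommGroup E]
    [Module A E] : Type _ :=
  R →ₗ[A] E

variable {A R E : Type*} [CommRing A] [CommRing R] [Algebra A R] [AddCommGroup E] [Module A E]

instance : AddCommGroup (Coinduced A R E) :=
  inferInstanceAs (AddCommGroup (R →ₗ[A] E))

instance : FunLike (Coinduced A R E) R E :=
  inferInstanceAs (FunLike (R →ₗ[A] E) R E)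

instance : LinearMapClass (Coinduced A R E) A R E :=
  inferInstanceAs (LinearMapClass (R →ₗ[A] E) A R E)

@[ext]
theorem Coinduced.ext {f g : Coinduced A R E} (h : ∀ x, f x = g x) : f = g :=
  DFunLike.ext f g h

theorem Coinduced.add_apply (f g : Coinduced A R E) (x : R) : (f + g) x = f x + g x := rfl

theorem Coinduced.zero_apply (x : R) : (0 : Coinduced A R E) x = 0 := rfl

noncomputable instance : SMul R (Coinduced A R E) where
  smul r f := LinearMap.comp (σ₁₂ := RingHom.id A) (f : R →ₗ[A] E) (LinearMap.mulLeft A r)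

theorem Coinduced.smul_apply (r : R) (f : Coinduced A R E) (x : R) : (r • f) x = f (r * x) := rfl

noncomputable instance : Module R (Coinduced A R E) where
  one_smul f := by ext x; rw [Coinduced.smul_apply, one_mul]
  mul_smul r s f := by
    ext x
    rw [Coinduced.smul_apply, Coinduced.smul_apply, Coinduced.smul_apply, mul_left_comm, mul_assoc]
  smul_zero r := rfl
  smul_add r f g := rfl
  add_smul r s f := by
    ext x
    rw [Coinduced.add_apply, Coinduced.smul_apply, add_mul, map_add]
    rfl
  zero_smul f := by ext x; rw [Coinduced.smul_apply, zero_mul, map_zero]; rfl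

/-- The map into the coinduced module adjoint to an `A`-linear map. -/
noncomputable def coinducedLift {X : Type*} [AddCommGroup X] [Module R X] [Module A X]
    [IsScalarTower A R X] (t : X →ₗ[A] E) : X →ₗ[R] Coinduced A R E where
  toFun x := t ∘ₗ (LinearMap.toSpanSingleton R X x).restrictScalars A
  map_add' x y := by
    refine Coinduced.ext fun r => ?_
    change t (r • (x + y)) = t (r • x) + t (r • y)
    rw [smul_add, map_add]
  map_smul' s x := by
    refine Coinduced.ext fun r => ?_
    change t (r • s • x) = t ((s * r) • x)
    rw [mul_comm, mul_smul]

theorem coinducedLift_apply {X : Type*} [AddCommGroup X] [Module R X] [Module A X]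
    [IsScalarTower A R X] (t : X →ₗ[A] E) (x : X) (r : R) : coinducedLift t x r = t (r • x) := rfl

end Coinduced

section ResidueTrace

variable {A : Type u} {R : Type v} [CommRing A] [IsLocalRing A] [CommRing R] [IsLocalRing R]
  [Algebra A R] [Module.Finite A R]

/-- For residue fields `k ⊆ K`, the `k`-dual of `K` is generated over `K` by one functional. -/
theorem exists_generator_dual_residueField :
    ∃ l : ResidueField R →ₗ[A] ResidueField A, l 1 ≠ 0 ∧
      ∀ l' : ResidueField R →ₗ[A] ResidueField A, ∃ α, ∀ x, l' x = l (α * x) := by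
  have := isLocalHom_algebraMap_of_finite A R
  obtain ⟨l, hl⟩ : ∃ l : Module.Dual (ResidueField A) (ResidueField R), l 1 ≠ 0 := by
    by_contra! hne
    exact one_ne_zero ((Module.forall_dual_apply_eq_zero_iff (ResidueField A) _).1 hne)
  -- `α ↦ l (α * ·)` is injective since `l 1 ≠ 0`, hence bijective by equality of dimensions.
  let B : ResidueField R →ₗ[ResidueField A] Module.Dual (ResidueField A) (ResidueField R) :=
    (LinearMap.mul (ResidueField A) (ResidueField R)).compr₂ l
  have hB : Function.Injective B := by
    rw [← LinearMap.ker_eq_bot, LinearMap.ker_eq_bot']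
    intro α hα
    by_contra hα0
    have h1 : l (α * α⁻¹) = 0 := LinearMap.congr_fun hα α⁻¹
    rw [mul_inv_cancel₀ hα0] at h1
    exact hl h1
  have hB' : Function.Surjective B :=
    (LinearMap.injective_iff_surjective_of_finrank_eq_finrank
      Subspace.dual_finrank_eq.symm).1 hB
  refine ⟨l.restrictScalars A, hl, fun l' => ?_⟩
  obtain ⟨α, hα⟩ := hB' (l'.extendScalarsOfSurjective residue_surjective)
  exact ⟨α, fun x => (LinearMap.congr_fun hα x).symm⟩

variable {E : Type u} [AddCommGroup E] [Module A E] {i : ResidueField A →ₗ[A] E}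
  {E' : Type v} [AddCommGroup E'] [Module R E'] [Module A E'] [IsScalarTower A R E']
  {j : ResidueField R →ₗ[R] E'}

/-- `f` is determined by its values on finitely many generators of `R`, each killed by a power of
the maximal ideal of `A`. -/
theorem exists_pow_smul_coinduced_eq_zero [IsNoetherianRing A] [IsNoetherianRing R]
    (h : IsInjectiveHull A i) (f : Coinduced A R E) :
    ∃ N : ℕ, ∀ s ∈ maximalIdeal R ^ N, s • f = 0 := by
  classical
  obtain ⟨S, hS⟩ := Module.Finite.fg_top (R := A) (M := R)
  choose n hn using fun r : R => h.exists_pow_smul_eq_zero (f r)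
  obtain ⟨N, hN⟩ := exists_pow_maximalIdeal_le_map A R (S.sup n)
  have hkill : ∀ a ∈ maximalIdeal A ^ S.sup n, ∀ r : R, a • f r = 0 := by
    intro a ha r
    have hr : r ∈ Submodule.span A (S : Set R) := hS ▸ Submodule.mem_top
    induction hr using Submodule.span_induction with
    | mem r hr => exact hn r a (Ideal.pow_le_pow_right (Finset.le_sup hr) ha)
    | zero => rw [map_zero, smul_zero]
    | add x y _ _ hx hy => rw [map_add, smul_add, hx, hy, add_zero]
    | smul b x _ hx => rw [map_smul, smul_comm, hx, smul_zero]
  refine ⟨N, fun s hs => ?_⟩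
  have hs' := hN hs
  clear hs
  rw [Ideal.map] at hs'
  induction hs' using Submodule.span_induction with
  | mem s hs =>
    obtain ⟨a, ha, rfl⟩ := hs
    ext x
    rw [Coinduced.smul_apply, ← Algebra.smul_def, map_smul, hkill a ha]
    rfl
  | zero => rw [zero_smul]
  | add x y _ _ hx hy => rw [add_smul, hx, hy, add_zero]
  | smul b x _ hx => rw [smul_assoc, hx, smul_zero]

/-- The hull `E'` of the residue field of `R` represents the functor `X ↦ Hom_A(X, E)`, where `E`
is the hull of the residue field of `A`. -/
theorem exists_residue_trace [IsNoetherianRing A] [IsNoetherianRing R]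
    (h : IsInjectiveHull A i) (h' : IsInjectiveHull R j) :
    ∃ t : E' →ₗ[A] E, Function.Bijective (coinducedLift (R := R) t) := by
  obtain ⟨l, hl, hgen⟩ := exists_generator_dual_residueField (A := A) (R := R)
  obtain ⟨t, ht⟩ := h.baer.extension_property (j.restrictScalars A) h'.injective (i ∘ₗ l)
  have htj : ∀ x, t (j x) = i (l x) := fun x => LinearMap.congr_fun ht x
  have hlift : ∀ α r, coinducedLift (R := R) t (j α) r = i (l (α * residue R r)) := fun α r => by
    rw [coinducedLift_apply, ← map_smul, htj, Algebra.smul_def, ResidueField.algebraMap_eq,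
      mul_comm]
  have hinj : Function.Injective (coinducedLift (R := R) t) := by
    rw [← LinearMap.ker_eq_bot]
    refine h'.essential _ (eq_bot_iff.2 ?_)
    rintro _ ⟨hx, α, rfl⟩
    rw [Submodule.mem_bot]
    by_contra hne
    have hα : α ≠ 0 := fun h0 => hne (by rw [h0, map_zero])
    obtain ⟨r, hr⟩ := residue_surjective α⁻¹
    have h1 := hlift α r
    rw [LinearMap.mem_ker.1 hx, hr, mul_inv_cancel₀ hα] at h1
    exact hl (h.injective (h1.symm.trans (map_zero i).symm))
  refine ⟨t, hinj, ?_⟩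
  -- Injectivity of `E'` splits the lift. A nonzero kernel of `ρ` would contain a nonzero socle
  -- element; such an element is a functional on the residue field of `R`, hence lies in the image
  -- of the lift, where `ρ` is injective.
  obtain ⟨ρ, hρ⟩ := h'.baer.extension_property (coinducedLift (R := R) t) hinj LinearMap.id
  have hρ' : ∀ y, ρ (coinducedLift t y) = y := fun y => LinearMap.congr_fun hρ y
  suffices hker : ∀ f, ρ f = 0 → f = 0 by
    intro f
    refine ⟨ρ f, (sub_eq_zero.1 (hker (f - coinducedLift t (ρ f)) ?_)).symm⟩
    rw [map_sub, hρ', sub_self]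
  intro f hf
  by_contra hf0
  classical
  have hex := exists_pow_smul_coinduced_eq_zero (R := R) h f
  obtain ⟨k, hk⟩ : ∃ k, Nat.find hex = k + 1 := Nat.exists_eq_succ_of_ne_zero fun h0 => by
    have := Nat.find_spec hex
    rw [h0, pow_zero, Ideal.one_eq_top] at this
    exact hf0 (by simpa using this 1 Submodule.mem_top)
  obtain ⟨s, hs, hsf⟩ : ∃ s ∈ maximalIdeal R ^ k, s • f ≠ 0 := by
    simpa using Nat.find_min hex (m := k) (by omega)
  have hkill : ∀ r ∈ maximalIdeal R, (s • f) r = 0 := fun r hr => by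
    have h1 := Nat.find_spec hex (r * s) (by rw [hk, pow_succ']; exact Ideal.mul_mem_mul hr hs)
    have h2 := congrArg (fun g : Coinduced A R E => g 1) h1
    simpa [Coinduced.smul_apply, Coinduced.zero_apply, mul_comm] using h2
  let q : ResidueField R →ₗ[A] E := Submodule.liftQ ((maximalIdeal R).restrictScalars A)
    (s • f : Coinduced A R E) hkill
  have hq : ∀ r, q (residue R r) = (s • f) r := fun r => rfl
  have hqi : ∀ x, q x ∈ LinearMap.range i := fun x => h.mem_range fun a ha => by
    obtain ⟨r, rfl⟩ := residue_surjective x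
    rw [hq, ← map_smul]
    refine hkill _ ?_
    rw [Algebra.smul_def]
    exact Ideal.mul_mem_right _ _ ((comap_maximalIdeal_of_finite A R).ge ha)
  obtain ⟨α, hα⟩ := hgen ((LinearEquiv.ofInjective i h.injective).symm.toLinearMap ∘ₗ
    q.codRestrict _ hqi)
  have hq' : ∀ x, q x = i (l (α * x)) := fun x => by
    rw [← hα]
    exact (congrArg Subtype.val
      ((LinearEquiv.ofInjective i h.injective).apply_symm_apply ⟨q x, hqi x⟩)).symm
  have heq : s • f = coinducedLift t (j α) := Coinduced.ext fun r => by rw [hlift, ← hq', hq]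
  have h0 : j α = 0 := by rw [← hρ' (j α), ← heq, map_smul, hf, smul_zero]
  exact hsf (by rw [heq, h0, map_zero])

end ResidueTrace

/-! ### The Matlis dual of `R ⊗ E_A(k)`. -/

section Duality

/-- The dual of `R ⊗ E` with respect to the trace `t` is `Hom_A(R, A)`. -/
theorem exists_dual_equiv {A R E E' : Type*} [CommRing A] [CommRing R] [Algebra A R]
    [AddCommGroup E] [Module A E] [AddCommGroup E'] [Module R E'] [Module A E']
    [IsScalarTower A R E'] (t : E' →ₗ[A] E) (ht : Function.Bijective (coinducedLift (R := R) t))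
    (huniq : ∀ a b : A, (∀ e : E, a • e = b • e) → a = b)
    (hend : ∀ g : E →ₗ[A] E, ∃ a : A, ∀ x, g x = a • x) :
    ∃ Φ : (R ⊗[A] E →ₗ[R] E') ≃+ (R →ₗ[A] A), ∀ f r e, t (f (r ⊗ₜ e)) = Φ f r • e := by
  -- For fixed `f` and `r`, `e ↦ t (f (r ⊗ e))` is an endomorphism of `E`, hence a scalar, which
  -- becomes `Φ f r`.
  have key : ∀ (f : R ⊗[A] E →ₗ[R] E') (r : R), ∃ a : A, ∀ e, t (f (r ⊗ₜ e)) = a • e :=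
    fun f r => hend (t ∘ₗ f.restrictScalars A ∘ₗ TensorProduct.mk A R E r)
  choose a ha using key
  let Φ : (R ⊗[A] E →ₗ[R] E') →+ (R →ₗ[A] A) := AddMonoidHom.mk' (fun f =>
    { toFun := a f
      map_add' := fun r s => huniq _ _ fun e => by
        rw [← ha, add_smul, ← ha, ← ha, TensorProduct.add_tmul, map_add, map_add]
      map_smul' := fun b r => huniq _ _ fun e => by
        rw [← ha, RingHom.id_apply, smul_assoc, ← ha, ← TensorProduct.smul_tmul',
          f.map_smul_of_tower, map_smul] }) fun f g => LinearMap.ext fun r => huniq _ _ fun e => by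
      change a (f + g) r • e = (a f r + a g r) • e
      rw [← ha, add_smul, ← ha, ← ha, LinearMap.add_apply, map_add]
  have hΦ : ∀ f r e, t (f (r ⊗ₜ e)) = Φ f r • e := ha
  refine ⟨AddEquiv.ofBijective Φ ⟨?_, fun φ => ?_⟩, hΦ⟩
  · refine (injective_iff_map_eq_zero Φ).2 fun f hf => LinearMap.ext fun z => ht.1 ?_
    rw [LinearMap.zero_apply, map_zero]
    refine Coinduced.ext fun s => ?_
    rw [coinducedLift_apply, ← map_smul]
    induction s • z using TensorProduct.induction_on with
    | zero => rw [map_zero, map_zero]; rfl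
    | tmul r e => rw [hΦ, hf, LinearMap.zero_apply, zero_smul]; rfl
    | add x y hx hy => rw [map_add, map_add, hx, hy, Coinduced.zero_apply, add_zero]
  · let g : R ⊗[A] E →ₗ[A] E := (TensorProduct.lid A E).toLinearMap ∘ₗ φ.rTensor E
    let σ := LinearEquiv.ofBijective (coinducedLift (R := R) t) ht
    -- The preimage of `φ` is the map to `E' ≅ Hom_A(R, E)` adjoint to `r ⊗ e ↦ φ r • e`.
    refine ⟨σ.symm.toLinearMap ∘ₗ coinducedLift g, LinearMap.ext fun r => huniq _ _ fun e => ?_⟩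
    rw [← hΦ]
    have h1 := congrArg (fun f : Coinduced A R E => f 1)
      (σ.apply_symm_apply (coinducedLift g (r ⊗ₜ e)))
    change t ((1 : R) • σ.symm (coinducedLift g (r ⊗ₜ e))) = g ((1 : R) • r ⊗ₜ[A] e) at h1
    rw [one_smul, one_smul] at h1
    simpa [g] using h1

/-- The Matlis dual of `R ⊗ E_A(k)` is `Hom_A(R, A)`. -/
theorem exists_matlisDual_equiv (A : Type u) (R : Type v) [CommRing A] [IsLocalRing A]
    [IsNoetherianRing A] [CommRing R] [IsLocalRing R] [IsNoetherianRing R] [Algebra A R]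
    [Module.Finite A R] [IsPrecomplete (maximalIdeal R) R]
    (hAR : Function.Injective (algebraMap A R)) :
    ∃ (t : ResidueHull R →+ ResidueHull A)
      (Φ : MatlisDual R (R ⊗[A] ResidueHull A) ≃+ (R →ₗ[A] A)),
      (∀ y, (∀ r : R, t (r • y) = 0) → y = 0) ∧
        ∀ f r e, t (f (r ⊗ₜ e)) = Φ f r • e := by
  obtain ⟨i, hi⟩ := residueHull_spec A
  obtain ⟨j, hj⟩ := residueHull_spec R
  let : Module A (ResidueHull R) := Module.compHom _ (algebraMap A R)
  have : IsScalarTower A R (ResidueHull R) := IsScalarTower.of_compHom A R _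
  have := isPrecomplete_of_finite A R hAR
  obtain ⟨t, ht⟩ := exists_residue_trace (A := A) (R := R) hi hj
  obtain ⟨Φ, hΦ⟩ := exists_dual_equiv t ht (fun _ _ => hi.eq_of_forall_smul_eq)
    hi.exists_forall_eq_smul
  refine ⟨t.toAddMonoidHom, Φ, fun y hy => ht.1 ?_, hΦ⟩
  rw [map_zero]
  exact Coinduced.ext hy

end Duality

/-! ### Nonvanishing and torsion-freeness of `Hom_A(R, A)`. -/

section Torsion

/-- A finite torsion-free extension of a domain `A` has a nonzero `A`-linear functional. -/
theorem exists_linearMap_ne_zero (A R : Type*) [CommRing A] [IsDomain A] [CommRing R] [IsDomain R]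
    [Algebra A R] [Module.Finite A R] (hAR : Function.Injective (algebraMap A R)) :
    ∃ φ : R →ₗ[A] A, φ ≠ 0 := by
  obtain ⟨c, hc, ι, _, π, b, h⟩ := exists_smul_eq_sum_smul A R
  by_contra! hne
  have h1 := h 1
  simp only [hne, LinearMap.zero_apply, zero_smul, Finset.sum_const_zero] at h1
  rw [Algebra.smul_def, mul_one, map_eq_zero_iff _ hAR] at h1
  exact hc h1

/-- The `R`-module `Hom_A(R, A)` is torsion-free. -/
theorem eq_zero_of_forall_mul_eq_zero {A R : Type*} [CommRing A] [IsDomain A] [CommRing R]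
    [IsDomain R] [Algebra A R] [Module.Finite A R] {φ : R →ₗ[A] A}
    {r : R} (hr : r ≠ 0) (h : ∀ x, φ (r * x) = 0) : φ = 0 := by
  -- By integrality a nonzero `r` divides a nonzero element of `A`.
  obtain ⟨a, ha, hra⟩ : ∃ a : A, a ≠ 0 ∧ algebraMap A R a ∈ Ideal.span {r} := by
    obtain ⟨a, ha, ha0⟩ := Submodule.exists_mem_ne_zero_of_ne_bot
      (Ideal.comap_ne_bot_of_integral_mem (R := A) hr (Ideal.mem_span_singleton_self r)
        (Algebra.IsIntegral.isIntegral r))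
    exact ⟨a, ha0, ha⟩
  obtain ⟨s, hs⟩ := Ideal.mem_span_singleton'.1 hra
  refine LinearMap.ext fun x => (mul_eq_zero.1 (?_ : a * φ x = 0)).resolve_left ha
  rw [← smul_eq_mul, ← map_smul, Algebra.smul_def, ← hs, mul_comm s, mul_assoc, h]

end Torsion

end TightClosure

theorem mainTheorem3 (p : ℕ) [Fact p.Prime] (A : Type u) (R : Type v)
    [CommRing A] [IsLocalRing A] [IsNoetherianRing A] [CharP A p]
    [CommRing R] [IsLocalRing R] [IsNoetherianRing R] [CharP R p]
    [Algebra A R] [Module.Finite A R] (hAR : Function.Injective (algebraMap A R))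
    (hA : TightClosure.IsFFinite p A) (hR : TightClosure.IsFFinite p R)
    [IsDomain R] [IsAdicComplete (IsLocalRing.maximalIdeal R) R] :
    TightClosure.IsStrongTestModule p R (TightClosure.relativeTestModule p A R) ∧
    ∃ Φ : TightClosure.MatlisDual R (R ⊗[A] TightClosure.ResidueHull A) ≃+ (R →ₗ[A] A),
      (∀ (r : R) (f : TightClosure.MatlisDual R (R ⊗[A] TightClosure.ResidueHull A)) (x : R),
        Φ (r • f) x = Φ f (r * x)) ∧
      ∀ f : TightClosure.MatlisDual R (R ⊗[A] TightClosure.ResidueHull A),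
        f ∈ TightClosure.relativeTestModule p A R ↔
          ∀ z ∈ TightClosure.finitisticTightClosure p
              (⊥ : Submodule R (R ⊗[A] TightClosure.ResidueHull A)),
            (Φ f).rTensor (TightClosure.ResidueHull A) z = 0 := by
  have : IsDomain A := hAR.isDomain (algebraMap A R)
  obtain ⟨i, hi⟩ := TightClosure.residueHull_spec A
  obtain ⟨t, Φ, ht, hΦ⟩ := TightClosure.exists_matlisDual_equiv A R hAR
  have hsmul : ∀ (r : R) (f : TightClosure.MatlisDual R (R ⊗[A] TightClosure.ResidueHull A))
      (x : R), Φ (r • f) x = Φ f (r * x) := fun r f x => hi.eq_of_forall_smul_eq fun e => by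
    rw [← hΦ, ← hΦ, LinearMap.smul_apply, ← map_smul, TensorProduct.smul_tmul', smul_eq_mul]
  refine ⟨⟨?_, TightClosure.hasStrongTestModuleProperty_finitisticTestModule p R _⟩,
    Φ, hsmul, fun f => ?_⟩
  · obtain ⟨C, hC, hCm⟩ := TightClosure.exists_smul_finitisticTightClosure_eq_zero p R hR
      (R ⊗[A] TightClosure.ResidueHull A)
    obtain ⟨φ, hφ⟩ := TightClosure.exists_linearMap_ne_zero A R hAR
    refine eq_bot_iff.2 fun r hr => ?_
    by_contra hr0
    have hmem : C • Φ.symm φ ∈ TightClosure.relativeTestModule p A R := fun x hx => by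
      rw [LinearMap.smul_apply, ← map_smul, hCm x hx, map_zero]
    have h1 : (r * C) • Φ.symm φ = 0 := by
      rw [mul_smul]
      exact congrArg Subtype.val (Module.mem_annihilator.1 hr ⟨_, hmem⟩)
    refine hφ (TightClosure.eq_zero_of_forall_mul_eq_zero (mul_ne_zero hr0 hC) fun x => ?_)
    have h2 := hsmul (r * C) (Φ.symm φ) x
    rw [h1, map_zero, AddEquiv.apply_symm_apply] at h2
    exact h2.symm
  · have htΦ : ∀ z, TensorProduct.lid A _ ((Φ f).rTensor (TightClosure.ResidueHull A) z) =
        t (f z) := fun z => by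
      induction z using TensorProduct.induction_on with
      | zero => simp only [map_zero]
      | tmul r e => rw [hΦ, LinearMap.rTensor_tmul, TensorProduct.lid_tmul]
      | add x y hx hy => simp only [map_add, hx, hy]
    constructor
    · intro hf z hz
      rw [← (TensorProduct.lid A _).map_eq_zero_iff, htΦ, hf z hz, map_zero]
    · intro hf z hz
      -- The finitistic tight closure is an `R`-submodule, so `t` vanishes on all of `R • f z`;
      -- nondegeneracy of `t` gives `f z = 0`.
      refine ht _ fun r => ?_
      rw [← map_smul, ← htΦ, hf _ (Submodule.smul_mem _ r hz), map_zero]
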